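/- Let $\omega_1,\omega_3\in\mathbb C$ be linearly independent over $\mathbb R$, let $\wp$ be the Weierstrass function with basic periods $(2\omega_1,2\omega_3)$, and put $\omega_0=0$, $\omega_2=-\omega_1-\omega_3$. Let $l_0,l_1,l_2,l_3\in\mathbb Z_{\ge 0}$, $M\in\mathbb Z_{\ge 0}$, $r_1,\dots,r_M\in\mathbb Z_{>0}$, $E,s_1,\dots,s_M\in\mathbb C$, and let $\delta_1,\dots,\delta_M\in\mathbb C\setminus(\mathbb Z\omega_1\oplus\mathbb Z\omega_3)$ be such that the values $\wp(\delta_1),\dots,\wp(\delta_M)$ are pairwise distinct. Put $$v(x)=\sum_{i=0}^3 l_i(l_i+1)\wp(x+\omega_i)+\sum_{i'=1}^M\left(\frac{r_{i'}}2\Big(\frac{r_{i'}}2+1\Big)\big(\wp(x-\delta_{i'})+\wp(x+\delta_{i'})\big)+\frac{s_{i'}}{\wp(x)-\wp(\delta_{i'})}\right),$$ $$H=-\frac{d^2}{dx^2}+v(x),\qquad \Psi_g(x)=\prod_{i'=1}^M(\wp(x)-\wp(\delta_{i'}))^{r_{i'}/2}.$$ Assume that the singular points $x=\pm\delta_{i'}$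 of the equation $(H-E)f=0$ are apparent, i.e. that near each of them there are two linearly independent solutions $f$ for which $f\,\Psi_g$ is single-valued and meromorphic (no logarithmic solutions). For $\epsilon_1,\epsilon_3\in\{\pm1\}$ let $\tilde{\mathcal F}_{\epsilon_1,\epsilon_3}$ be the space of (possibly two-valued) functions $f$ such that $g=f\,\Psi_g$ is a single-valued meromorphic function on $\mathbb C$ with $g(x+2\omega_1)=\epsilon_1 g(x)$ and $g(x+2\omega_3)=\epsilon_3 g(x)$, $g$ is holomorphic outside $\mathbb Z\omega_1\oplus\mathbb Z\omega_3$, and the order of the pole of $g$ at $\omega_i$ is at most $l_i$ for $i=1,2,3$ and at most $l_0+\sum_{i'=1}^M r_{i'}$ for $i=0$. Assume that the vector space of even meromorphic functions with periods $2\omega_1,2\omega_3$ which satisfy $$\Xi'''(x)-4(v(x)-E)\,\Xi'(x)-2v'(x)\,\Xi(x)=0$$ has dimension one, and let $\Xi$ be a nonzero element of it. Then $$Q=\Xi(x)^2(E-v(x))+\tfrac12\,\Xi(x)\,\Xi''(x)-\tfrac14\,\Xi'(x)^2$$ does not depend on $x$, and $Q=0$ if and only if the equation $(H-E)f=0$ has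 a nonzero solution $f$ in $\tilde{\mathcal F}_{\epsilon_1,\epsilon_3}$ for some $\epsilon_1,\epsilon_3\in\{\pm1\}$. -/

import Mathlib

open Filter Topology

noncomputable section

/-- The parameters of the equation `(H - E) f = 0`.  The basic periods `(2ω₁, 2ω₃)` of the
elliptic functions are `(lattice.ω₁, lattice.ω₂)`. -/
structure EllipticParams where
  lattice : PeriodPair
  l : Fin 4 → ℕ
  M : ℕ
  r : Fin M → ℕ
  δ : Fin M → ℂ
  s : Fin M → ℂ
  E : ℂ

namespace EllipticParams

variable (P : EllipticParams)

/-- The Weierstrass function of the lattice `2ω₁ℤ ⊕ 2ω₃ℤ`. -/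
def wp (x : ℂ) : ℂ := P.lattice.weierstrassP x

/-- The half periods: `ω₀ = 0`, `ω₁`, `ω₂ = - ω₁ - ω₃`, `ω₃`. -/
def ω : Fin 4 → ℂ :=
  ![0, P.lattice.ω₁ / 2, -(P.lattice.ω₁ / 2) - P.lattice.ω₂ / 2, P.lattice.ω₂ / 2]

/-- The standing assumptions on the positions of the singular points and on the exponents:
`r i > 0`, the points `b i = ℘(δ i)` are finite and different from `e₁, e₂, e₃` (i.e. `δ i` is not
a half period), and they are pairwise distinct. -/
structure Admissible : Prop where
  r_pos : ∀ i, 0 < P.r i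
  two_mul_δ_notMem : ∀ i, 2 * P.δ i ∉ P.lattice.lattice
  b_injective : Function.Injective fun i => P.wp (P.δ i)

/-- The half-period lattice `ℤω₁ ⊕ ℤω₃`. -/
def halfLattice : Set ℂ := {x | 2 * x ∈ P.lattice.lattice}

/-- The points which are congruent to a half period or to some `± δ i`. -/
def sing : Set ℂ :=
  P.halfLattice ∪ {x | ∃ i, x - P.δ i ∈ P.lattice.lattice ∨ x + P.δ i ∈ P.lattice.lattice}

/-- The potential `v`; only its values outside `sing` are used. -/
def v (x : ℂ) : ℂ :=
  ∑ i : Fin 4, (P.l i : ℂ) * ((P.l i : ℂ) + 1) * P.wp (x + P.ω i)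
    + ∑ i : Fin P.M,
      ((P.r i : ℂ) / 2 * ((P.r i : ℂ) / 2 + 1) * (P.wp (x - P.δ i) + P.wp (x + P.δ i))
        + P.s i / (P.wp x - P.wp (P.δ i)))

/-- `ψ` is, near `x`, a holomorphic branch of the (in general two-valued) function
`Ψ_g = ∏ i, (℘ - ℘(δ i)) ^ (r i / 2)`. -/
def IsBranchPsi (ψ : ℂ → ℂ) (x : ℂ) : Prop :=
  AnalyticAt ℂ ψ x ∧ ∀ᶠ y in 𝓝 x, ψ y ^ 2 = ∏ i : Fin P.M, (P.wp y - P.wp (P.δ i)) ^ P.r i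

/-- The (in general two-valued) function `f = g / Ψ_g` satisfies `-f'' + v f - E f = 0` at `x`.
Both branches of `Ψ_g` are considered; they differ by a sign. -/
def SolvesHAt (g : ℂ → ℂ) (x : ℂ) : Prop :=
  ∀ ψ : ℂ → ℂ, P.IsBranchPsi ψ x →
    -iteratedDeriv 2 (fun y => g y / ψ y) x + (P.v x - P.E) * (g x / ψ x) = 0

/-- The singular point `a` (which will be one of the `± δ i`) of `(H - E) f = 0` is apparent: near
`a` there are no logarithmic solutions, i.e. there are two linearly independent solutions `f`
for which `f Ψ_g` is single-valued and meromorphic at `a`. -/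
def IsApparent (a : ℂ) : Prop :=
  ∃ g₁ g₂ : ℂ → ℂ, MeromorphicAt g₁ a ∧ MeromorphicAt g₂ a ∧
    (∀ᶠ x in 𝓝[≠] a, P.SolvesHAt g₁ x ∧ P.SolvesHAt g₂ x) ∧
    ∀ c₁ c₂ : ℂ, (∀ᶠ x in 𝓝[≠] a, c₁ * g₁ x + c₂ * g₂ x = 0) → c₁ = 0 ∧ c₂ = 0

/-- The space `𝓕_{ε₁,ε₃}`; the two identities are identities of meromorphic functions, that is,
they hold outside a discrete closed set. -/
def calF (ε₁ ε₃ : ℂ) : Set (ℂ → ℂ) :=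
  {g | Meromorphic g ∧
    (∀ᶠ x in codiscrete ℂ, g (x + 2 * P.ω 1) = ε₁ * g x) ∧
    (∀ᶠ x in codiscrete ℂ, g (x + 2 * P.ω 3) = ε₃ * g x)}

/-- The space `𝓕̃_{ε₁,ε₃}`.  An element `f` of that space is in general two-valued, and it is
represented here by the single-valued function `g = f Ψ_g`. -/
def tildeF (ε₁ ε₃ : ℂ) : Set (ℂ → ℂ) :=
  {g | g ∈ P.calF ε₁ ε₃ ∧ AnalyticOnNhd ℂ g P.halfLatticeᶜ ∧
    (∀ i : Fin 4, i ≠ 0 → ((-(P.l i : ℤ) : ℤ) : WithTop ℤ) ≤ meromorphicOrderAt g (P.ω i)) ∧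
    ((-((P.l 0 : ℤ) + ∑ i, (P.r i : ℤ)) : ℤ) : WithTop ℤ) ≤ meromorphicOrderAt g (P.ω 0)}

/-- `(H - E) f = 0` has a nonzero solution `f` in `𝓕̃_{ε₁,ε₃}` (represented by `g = f Ψ_g`). -/
def HasSolutionInTildeF (ε₁ ε₃ : ℂ) : Prop :=
  ∃ g ∈ P.tildeF ε₁ ε₃, (∃ x ∉ P.sing, g x ≠ 0) ∧ ∀ x ∉ P.sing, P.SolvesHAt g x

/-- The vector space of the even doubly-periodic meromorphic functions `Ξ`, with periods
`2ω₁, 2ω₃`, that satisfy `Ξ''' - 4 (v - E) Ξ' - 2 v' Ξ = 0`.  Solutions are holomorphic outside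
`sing`; each of them is represented by the function that has the value `0` on `sing`, so that
equal meromorphic functions have equal representatives. -/
def evenPeriodicSol : Submodule ℂ (ℂ → ℂ) where
  carrier := {Ξ | Meromorphic Ξ ∧ AnalyticOnNhd ℂ Ξ P.singᶜ ∧ (∀ x ∈ P.sing, Ξ x = 0) ∧
    (∀ x, Ξ (-x) = Ξ x) ∧ (∀ x, Ξ (x + 2 * P.ω 1) = Ξ x) ∧ (∀ x, Ξ (x + 2 * P.ω 3) = Ξ x) ∧
    ∀ x ∉ P.sing, iteratedDeriv 3 Ξ x - 4 * (P.v x - P.E) * deriv Ξ x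
      - 2 * deriv P.v x * Ξ x = 0}
  zero_mem' := by
    refine ⟨fun x => ?_, fun x _ => analyticAt_const, fun _ _ => rfl, fun _ => rfl, fun _ => rfl,
      fun _ => rfl, fun x _ => ?_⟩
    · exact MeromorphicAt.const 0 x
    · have h0 : (0 : ℂ → ℂ) = fun _ => (0 : ℂ) := rfl
      rw [h0, iteratedDeriv_const]
      simp
  add_mem' := by
    rintro a b ⟨ha, ha1, ha2, ha3, ha4, ha5, ha6⟩ ⟨hb, hb1, hb2, hb3, hb4, hb5, hb6⟩
    refine ⟨fun x => (ha x).add (hb x), fun x hx => (ha1 x hx).add (hb1 x hx), fun x hx => ?_,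
      fun x => ?_, fun x => ?_, fun x => ?_, fun x hx => ?_⟩
    · simp [ha2 x hx, hb2 x hx]
    · simp [ha3 x, hb3 x]
    · simp [ha4 x, hb4 x]
    · simp [ha5 x, hb5 x]
    · have h1 := ha6 x hx
      have h2 := hb6 x hx
      rw [iteratedDeriv_add (ha1 x hx).contDiffAt (hb1 x hx).contDiffAt,
        deriv_add (ha1 x hx).differentiableAt (hb1 x hx).differentiableAt]
      simp only [Pi.add_apply]
      linear_combination h1 + h2
  smul_mem' := by
    rintro c a ⟨ha, ha1, ha2, ha3, ha4, ha5, ha6⟩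
    refine ⟨fun x => (MeromorphicAt.const c x).mul (ha x),
      fun x hx => analyticAt_const.mul (ha1 x hx), fun x hx => ?_,
      fun x => ?_, fun x => ?_, fun x => ?_, fun x hx => ?_⟩
    · simp [ha2 x hx]
    · simp [ha3 x]
    · simp [ha4 x]
    · simp [ha5 x]
    · have h1 := ha6 x hx
      rw [iteratedDeriv_const_smul_field, deriv_const_smul_field]
      simp only [Pi.smul_apply, smul_eq_mul]
      linear_combination c * h1

/-- The expression `Ξ² (E - v) + Ξ Ξ'' / 2 - (Ξ')² / 4`, whose constant value is `Q`. -/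
def Qexpr (Ξ : ℂ → ℂ) (x : ℂ) : ℂ :=
  Ξ x ^ 2 * (P.E - P.v x) + 1 / 2 * Ξ x * iteratedDeriv 2 Ξ x - 1 / 4 * deriv Ξ x ^ 2

end EllipticParams

end

/-!
Wherever `f'' = (v - E) f` and `Ξ = f ^ 2`, the expression
`Q = Ξ ^ 2 (E - v) + Ξ Ξ'' / 2 - Ξ' ^ 2 / 4` equals `f ^ 3 (f'' - (v - E) f) = 0`
(`first_integral_sq`), and products of two solutions of the second order equation solve the third
order one (`third_order_of_mul`). The derivative of `Q` is a multiple of the third order equation,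
so `Q` is constant on the complement of the singular set, which is connected
(`EllipticParams.Admissible.exists_Qexpr_eq`).

Suppose that `Q = 0`. Then the order `m` of `Ξ` at a point where the double pole of `v` has
coefficient `c` satisfies `m (m - 2) = 4 c` (`order_mul_order_sub_two_of_first_integral_zero`). With
`c = l (l + 1)` at the half periods, `c = (r / 2) (r / 2 + 1)` at the points `± δ` and `c = 0`
elsewhere, this makes all orders of `Ξ Ψ_g ^ 2` even and bounds them from below
(`EllipticParams.Admissible.exists_order_mul_psiSq`). A meromorphic function on the plane with even
orders is a square (`Meromorphic.exists_sq_eq`), and a square root `g` of `Ξ Ψ_g ^ 2` represents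
the solution `f = √Ξ`; translation by a period changes `g` at most by a sign.

Conversely, let `f` be a solution in one of the spaces. Then `f(x) f(-x)` is a nonzero even elliptic
solution of the third order equation, and so is, up to vanishing, the product built in the same way
from `f(x) + f(-x)` (`EllipticParams.IsSol.symmProd_mem`). As the space of such solutions is
one-dimensional, `f(x) / f(-x)` is a root of a quadratic polynomial with constant coefficients,
hence constant. Therefore `Ξ` is a multiple of `f ^ 2`, and `Q = 0`.

The zeros and poles of `Ψ_g ^ 2 = ∏ (℘ - ℘(δ)) ^ r` are known once `℘(a) = ℘(b)` is shown to imply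
`a ≡ ± b`, and `℘'(a) = 0` to imply `2 a ≡ 0`. Both follow from the uniqueness of solutions of
`℘'' = 6 ℘ ^ 2 - g₂ / 2` (`PeriodPair.sub_mem_lattice_of_weierstrassP_eq`).
-/

noncomputable section

/-! ### Second order equations and their symmetric squares -/

/-- Differentiation of a Laurent-type factorization `f = (z - a) ^ m * h`. -/
lemma deriv_eventuallyEq_zpow_mul {f h : ℂ → ℂ} {a : ℂ} {m : ℤ} (hh : AnalyticAt ℂ h a)
    (hf : ∀ᶠ z in 𝓝[≠] a, f z = (z - a) ^ m * h z) :
    ∀ᶠ z in 𝓝[≠] a, deriv f z = (z - a) ^ (m - 1) * (m * h z + (z - a) * deriv h z) := by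
  filter_upwards [eventually_eventually_nhdsWithin.2 hf, self_mem_nhdsWithin,
    hh.eventually_analyticAt.filter_mono nhdsWithin_le_nhds] with z hz hza hhz
  have hza' : z - a ≠ 0 := sub_ne_zero.2 hza
  have h1 : f =ᶠ[𝓝 z] fun y => (y - a) ^ m * h y := by
    rwa [isOpen_compl_singleton.nhdsWithin_eq hza] at hz
  rw [h1.deriv_eq]
  have h2 : HasDerivAt (fun y => (y - a) ^ m) (m * (z - a) ^ (m - 1) * 1) z :=
    HasDerivAt.comp (h₂ := fun w : ℂ => w ^ m) z (hasDerivAt_zpow m (z - a) (Or.inl hza'))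
      ((hasDerivAt_id z).sub_const a)
  rw [(h2.fun_mul hhz.differentiableAt.hasDerivAt).deriv]
  have : (z - a) ^ m = (z - a) ^ (m - 1) * (z - a) := by
    rw [← zpow_add_one₀ hza']; simp
  rw [this]; ring

/-- The indicial equation for a function `Ξ` whose quadratic first integral vanishes: if
`(x - a) ^ 2 * v x` tends to `c` then the order `m` of `Ξ` at `a` satisfies `m (m - 2) = 4 c`. -/
lemma order_mul_order_sub_two_of_first_integral_zero {X v : ℂ → ℂ} {a c E : ℂ} {m : ℤ}
    (hX : MeromorphicAt X a) (hm : meromorphicOrderAt X a = m)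
    (hv : Tendsto (fun x => (x - a) ^ 2 * v x) (𝓝[≠] a) (𝓝 c))
    (hQ : ∀ᶠ x in 𝓝[≠] a,
      X x ^ 2 * (E - v x) + 1 / 2 * X x * iteratedDeriv 2 X x - 1 / 4 * deriv X x ^ 2 = 0) :
    (m : ℂ) * (m - 2) = 4 * c := by
  obtain ⟨h, hh, h0, hf⟩ := (meromorphicOrderAt_eq_int_iff hX).1 hm
  simp only [smul_eq_mul] at hf
  have hd1 := deriv_eventuallyEq_zpow_mul hh hf
  set h1 : ℂ → ℂ := fun z => m * h z + (z - a) * deriv h z with h1def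
  have hh1 : AnalyticAt ℂ h1 a := by
    have := hh.deriv
    fun_prop
  have hd2 := deriv_eventuallyEq_zpow_mul hh1 hd1
  set h2 : ℂ → ℂ := fun z => ((m - 1 : ℤ) : ℂ) * h1 z + (z - a) * deriv h1 z with h2def
  have hh2 : AnalyticAt ℂ h2 a := by
    have := hh1.deriv
    fun_prop
  -- the first integral divided by `(z - a) ^ (2 * m - 2)`; its limit is the indicial polynomial
  have key : ∀ᶠ z in 𝓝[≠] a, h z ^ 2 * ((z - a) ^ 2 * E - (z - a) ^ 2 * v z) + 1 / 2 * h z * h2 z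
      - 1 / 4 * h1 z ^ 2 = 0 := by
    filter_upwards [hf, hd1, hd2, hQ, self_mem_nhdsWithin] with z e0 e1 e2 e3 hza
    have hza' : z - a ≠ 0 := sub_ne_zero.2 hza
    rw [iteratedDeriv_succ, iteratedDeriv_one, e0, e1, e2] at e3
    have hp : (z - a) ^ (m - 1) ≠ 0 := zpow_ne_zero _ hza'
    have em : (z - a) ^ m = (z - a) ^ (m - 1) * (z - a) := by
      rw [← zpow_add_one₀ hza']; simp
    have em2 : (z - a) ^ (m - 1) = (z - a) ^ (m - 1 - 1) * (z - a) := by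
      rw [← zpow_add_one₀ hza']; simp
    have hp2 : (z - a) ^ (m - 1 - 1) ≠ 0 := zpow_ne_zero _ hza'
    rw [em, em2] at e3
    have : ((z - a) ^ (m - 1 - 1)) ^ 2 * (z - a) ^ 2 *
        (h z ^ 2 * ((z - a) ^ 2 * E - (z - a) ^ 2 * v z) + 1 / 2 * h z * h2 z
          - 1 / 4 * h1 z ^ 2) = 0 := by
      rw [← e3]; ring
    simpa [hp2, hza'] using this
  have t0 : Tendsto (fun z => (z - a) ^ 2 * E) (𝓝[≠] a) (𝓝 ((a - a) ^ 2 * E)) :=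
    (Continuous.tendsto (by fun_prop) a).mono_left nhdsWithin_le_nhds
  have th := hh.continuousAt.tendsto.mono_left (nhdsWithin_le_nhds (s := {a}ᶜ))
  have th1 := hh1.continuousAt.tendsto.mono_left (nhdsWithin_le_nhds (s := {a}ᶜ))
  have th2 := hh2.continuousAt.tendsto.mono_left (nhdsWithin_le_nhds (s := {a}ᶜ))
  have T := (((th.pow 2).mul (t0.sub hv)).add ((th.const_mul (1 / 2)).mul th2)).sub
    ((th1.pow 2).const_mul (1 / 4))
  have := tendsto_nhds_unique_of_eventuallyEq T tendsto_const_nhds key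
  simp only [h2def, h1def, sub_self, zero_mul, add_zero] at this
  have h3 : h a ^ 2 * ((m : ℂ) * (m - 2) - 4 * c) = 0 := by
    push_cast at this
    linear_combination 4 * this
  rcases mul_eq_zero.1 h3 with h4 | h4
  · exact absurd (pow_eq_zero_iff (by norm_num) |>.1 h4) h0
  · linear_combination h4

/-- The first integral of the square of an analytic function, in terms of the Schrödinger
operator. -/
lemma first_integral_sq {f : ℂ → ℂ} {x : ℂ} (hf : AnalyticAt ℂ f x) (w : ℂ) :
    (f x ^ 2) ^ 2 * w + 1 / 2 * f x ^ 2 * iteratedDeriv 2 (fun y => f y ^ 2) x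
      - 1 / 4 * deriv (fun y => f y ^ 2) x ^ 2 = f x ^ 3 * (iteratedDeriv 2 f x + w * f x) := by
  have h1 : ∀ᶠ y in 𝓝 x, deriv (fun y => f y ^ 2) y = 2 * (f y * deriv f y) := by
    filter_upwards [hf.eventually_analyticAt] with y hy
    rw [(hy.differentiableAt.hasDerivAt.fun_pow 2).deriv]
    push_cast; ring
  have h2 : deriv (deriv fun y => f y ^ 2) x
      = 2 * (deriv f x * deriv f x + f x * deriv (deriv f) x) := by
    rw [EventuallyEq.deriv_eq h1]
    exact ((hf.differentiableAt.hasDerivAt.mul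
      hf.deriv.differentiableAt.hasDerivAt).const_mul 2).deriv
  simp only [iteratedDeriv_succ, iteratedDeriv_zero]
  rw [h2, h1.self_of_nhds]
  ring

/-- The product of two solutions of `f'' = u f` solves the symmetric square of that equation. -/
lemma third_order_of_mul {f₁ f₂ u : ℂ → ℂ} {x : ℂ} (hf₁ : AnalyticAt ℂ f₁ x)
    (hf₂ : AnalyticAt ℂ f₂ x) (hu : DifferentiableAt ℂ u x)
    (h₁ : ∀ᶠ y in 𝓝 x, iteratedDeriv 2 f₁ y = u y * f₁ y)
    (h₂ : ∀ᶠ y in 𝓝 x, iteratedDeriv 2 f₂ y = u y * f₂ y) :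
    iteratedDeriv 3 (fun y => f₁ y * f₂ y) x = 4 * u x * deriv (fun y => f₁ y * f₂ y) x
      + 2 * deriv u x * (f₁ x * f₂ x) := by
  simp only [iteratedDeriv_succ, iteratedDeriv_zero] at h₁ h₂ ⊢
  have e1 : ∀ᶠ y in 𝓝 x, deriv (fun y => f₁ y * f₂ y) y =
      deriv f₁ y * f₂ y + f₁ y * deriv f₂ y := by
    filter_upwards [hf₁.eventually_analyticAt, hf₂.eventually_analyticAt] with y h h'
    exact (h.differentiableAt.hasDerivAt.fun_mul h'.differentiableAt.hasDerivAt).deriv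
  have e2 : ∀ᶠ y in 𝓝 x, deriv (deriv (fun y => f₁ y * f₂ y)) y
      = 2 * (u y * (f₁ y * f₂ y)) + 2 * (deriv f₁ y * deriv f₂ y) := by
    filter_upwards [hf₁.eventually_analyticAt, hf₂.eventually_analyticAt,
      e1.eventually_nhds, h₁, h₂] with y h h' e a1 a2
    rw [EventuallyEq.deriv_eq e, ((h.deriv.differentiableAt.hasDerivAt.fun_mul
      h'.differentiableAt.hasDerivAt).fun_add (h.differentiableAt.hasDerivAt.fun_mul
      h'.deriv.differentiableAt.hasDerivAt)).deriv, a1, a2]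
    ring
  have d1 := hf₁.differentiableAt.hasDerivAt
  have d2 := hf₂.differentiableAt.hasDerivAt
  rw [EventuallyEq.deriv_eq e2, e1.self_of_nhds,
    (((hu.hasDerivAt.fun_mul (d1.fun_mul d2)).const_mul 2).fun_add
      ((hf₁.deriv.differentiableAt.hasDerivAt.fun_mul
        hf₂.deriv.differentiableAt.hasDerivAt).const_mul 2)).deriv,
    h₁.self_of_nhds, h₂.self_of_nhds]
  ring

/-! ### Square roots of meromorphic functions -/

/-- On a disc, a nonvanishing holomorphic function has a holomorphic square root. -/
lemma exists_sq_eq_on_ball {u : ℂ → ℂ} {c : ℂ} {R : ℝ} (hR : 0 < R)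
    (hu : AnalyticOnNhd ℂ u (Metric.ball c R)) (h0 : ∀ z ∈ Metric.ball c R, u z ≠ 0) :
    ∃ k : ℂ → ℂ, AnalyticOnNhd ℂ k (Metric.ball c R) ∧ ∀ z ∈ Metric.ball c R, k z ^ 2 = u z := by
  obtain ⟨η, hη⟩ := DifferentiableOn.isExactOn_ball (c := c) (r := R)
    (f := fun z => deriv u z / u z) fun z hz => ((hu z hz).deriv.differentiableAt.div
      (hu z hz).differentiableAt (h0 z hz)).differentiableWithinAt
  have hηa : AnalyticOnNhd ℂ η (Metric.ball c R) :=
    DifferentiableOn.analyticOnNhd (fun z hz => (hη z hz).differentiableAt.differentiableWithinAt)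
      Metric.isOpen_ball
  -- `η` is a logarithm of `u` up to an additive constant
  have hconst : ∀ z ∈ Metric.ball c R,
      u z * Complex.exp (-η z) = u c * Complex.exp (-η c) := by
    intro z hz
    refine Metric.isOpen_ball.is_const_of_deriv_eq_zero (𝕜 := ℂ)
      (f := fun z => u z * Complex.exp (-η z)) (convex_ball c R).isPreconnected ?_ ?_ hz
      (Metric.mem_ball_self hR)
    · exact fun y hy => ((hu y hy).differentiableAt.mul
        (hη y hy).differentiableAt.neg.cexp).differentiableWithinAt
    · intro y hy
      have := ((hu y hy).differentiableAt.hasDerivAt.fun_mul (hη y hy).fun_neg.cexp).deriv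
      rw [this]
      have := h0 y hy
      simp only [Pi.zero_apply]
      field_simp
      ring
  obtain ⟨C, hC⟩ := IsAlgClosed.exists_pow_nat_eq (u c * Complex.exp (-η c)) (n := 2) (by norm_num)
  refine ⟨fun z => C * Complex.exp (η z / 2), fun z hz => ?_, fun z hz => ?_⟩
  · have := hηa z hz
    fun_prop
  · rw [mul_pow, hC, ← hconst z hz, ← Complex.exp_nat_mul, mul_assoc, ← Complex.exp_add]
    ring_nf
    simp

/-- A nonvanishing analytic germ has an analytic square root. -/
lemma AnalyticAt.exists_sq_eq {F : ℂ → ℂ} {x : ℂ} (hF : AnalyticAt ℂ F x) (h0 : F x ≠ 0) :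
    ∃ ψ : ℂ → ℂ, AnalyticAt ℂ ψ x ∧ ∀ᶠ y in 𝓝 x, ψ y ^ 2 = F y := by
  obtain ⟨R, hR, h⟩ := Metric.eventually_nhds_iff_ball.1
    (hF.eventually_analyticAt.and (hF.continuousAt.eventually_ne h0))
  obtain ⟨k, hk, hk2⟩ := exists_sq_eq_on_ball hR (fun z hz => (h z hz).1) fun z hz => (h z hz).2
  exact ⟨k, hk x (Metric.mem_ball_self hR),
    Filter.eventually_of_mem (Metric.ball_mem_nhds x hR) hk2⟩

/-- Two meromorphic functions in normal form with the same square agree up to a global sign. -/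
lemma MeromorphicNFOn.eqOn_or_eqOn_neg {g k : ℂ → ℂ} {U : Set ℂ} (hU : IsPreconnected U)
    (hg : MeromorphicNFOn g U) (hk : MeromorphicNFOn k U)
    (h : ∀ a ∈ U, ∀ᶠ z in 𝓝[≠] a, g z ^ 2 = k z ^ 2) :
    (∀ z ∈ U, g z = k z) ∨ ∀ z ∈ U, g z = -k z := by
  have hnk : MeromorphicNFOn (fun z => -k z) U := fun z hz => by
    have := (hk hz).smul_analytic (analyticAt_const (v := (-1 : ℂ))) (by norm_num)
    convert this using 1
    ext; simp
  by_cases hall : ∀ a ∈ U, meromorphicOrderAt (fun z => g z - k z) a = ⊤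
  · left
    intro z hz
    have h1 := meromorphicOrderAt_eq_top_iff.1 (hall z hz)
    have h2 : g =ᶠ[𝓝[≠] z] k := h1.mono fun y hy => sub_eq_zero.1 hy
    exact (((hg hz).eventuallyEq_nhdsNE_iff_eventuallyEq_nhds (hk hz)).1 h2).self_of_nhds
  · right
    push Not at hall
    obtain ⟨b, hb, hb'⟩ := hall
    intro z hz
    have m1 : MeromorphicOn (fun z => g z - k z) U :=
      fun y hy => (hg hy).meromorphicAt.sub (hk hy).meromorphicAt
    have h1 := m1.meromorphicOrderAt_ne_top_of_isPreconnected hU hb hz hb'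
    have h3 := (meromorphicOrderAt_ne_top_iff_eventually_ne_zero (m1 z hz)).1 h1
    have h2 : g =ᶠ[𝓝[≠] z] fun z => -k z := by
      filter_upwards [h3, h z hz] with y hy hy2
      have : (g y - k y) * (g y + k y) = 0 := by linear_combination hy2
      have := (mul_eq_zero.1 this).resolve_left hy
      linear_combination this
    exact (((hg hz).eventuallyEq_nhdsNE_iff_eventuallyEq_nhds (hnk hz)).1 h2).self_of_nhds

/-- A meromorphic function of even orders has a meromorphic square root on every disc: after half of
the finitely many zeros and poles is split off as a rational factor, a nonvanishing function
remains. -/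
lemma Meromorphic.exists_sq_eq_on_ball {F : ℂ → ℂ} (hF : Meromorphic F)
    (hev : ∀ a, ∃ n : ℤ, meromorphicOrderAt F a = ((2 * n : ℤ) : WithTop ℤ)) {R : ℝ} (hR : 0 < R) :
    ∃ g : ℂ → ℂ, MeromorphicNFOn g (Metric.ball 0 R) ∧
      ∀ a ∈ Metric.ball (0 : ℂ) R, ∀ᶠ z in 𝓝[≠] a, g z ^ 2 = F z := by
  have hFo : MeromorphicOn F (Metric.closedBall 0 R) := fun z _ => hF z
  set D := MeromorphicOn.divisor F (Metric.closedBall 0 R) with hD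
  have hfin : D.support.Finite := D.finiteSupport (isCompact_closedBall 0 R)
  obtain ⟨u, hu, hu0, hFu⟩ := hFo.extract_zeros_poles (fun z => by
    obtain ⟨n, hn⟩ := hev z; rw [hn]; exact WithTop.coe_ne_top) hfin
  obtain ⟨k, hk, hk2⟩ := _root_.exists_sq_eq_on_ball hR
    (fun z hz => hu z (Metric.ball_subset_closedBall hz))
    (fun z hz => hu0 ⟨z, Metric.ball_subset_closedBall hz⟩)
  have hDev : ∀ z, D z = 2 * (D z / 2) := by
    intro z
    by_cases hz : z ∈ Metric.closedBall (0 : ℂ) R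
    · obtain ⟨n, hn⟩ := hev z
      have : D z = 2 * n := by
        rw [hD, MeromorphicOn.divisor_apply hFo hz, hn]; rfl
      omega
    · have : D z = 0 := D.apply_eq_zero_of_notMem hz
      omega
  set p : ℂ → ℂ := ∏ᶠ w, (fun z => z - w) ^ (D w / 2) with hp
  have hpm : Meromorphic p := fun z =>
    ((Function.FactorizedRational.meromorphicNFOn_univ fun w => D w / 2) trivial).meromorphicAt
  have hp2 : p ^ 2 = ∏ᶠ w, (fun z => z - w) ^ D w := by
    rw [hp, finprod_pow]
    · refine finprod_congr fun w => ?_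
      rw [← zpow_natCast, ← zpow_mul]
      congr 1
      have := hDev w
      push_cast; omega
    · refine hfin.subset fun w hw => ?_
      simp only [Function.mem_support, Function.mem_mulSupport] at hw ⊢
      intro h
      exact hw (by simp [h])
  have hpk : MeromorphicOn (p * k) (Metric.ball 0 R) :=
    fun z hz => (hpm z).mul (hk z hz).meromorphicAt
  refine ⟨toMeromorphicNFOn (p * k) (Metric.ball 0 R), meromorphicNFOn_toMeromorphicNFOn _ _,
    fun a ha => ?_⟩
  have h1 : ∀ᶠ z in 𝓝[≠] a, F z = ((∏ᶠ w, (fun z => z - w) ^ D w) • u) z := by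
    have h2 := mem_codiscreteWithin_iff_forall_mem_nhdsNE.1 hFu a
      (Metric.ball_subset_closedBall ha)
    filter_upwards [h2, mem_nhdsWithin_of_mem_nhds (Metric.closedBall_mem_nhds_of_mem ha)]
      with z hz hz'
    rcases hz with hz | hz
    · exact hz
    · exact absurd hz' hz
  filter_upwards [hpk.toMeromorphicNFOn_eq_self_on_nhdsNE ha, h1,
    mem_nhdsWithin_of_mem_nhds (Metric.isOpen_ball.mem_nhds ha)] with z e1 e2 hz
  rw [e1, e2, ← hp2]
  simp only [Pi.mul_apply, Pi.smul_apply', Pi.pow_apply, smul_eq_mul, mul_pow, hk2 z hz]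

/-- A meromorphic function on the plane all of whose orders are even is the square of a meromorphic
function: the square roots on growing discs can be chosen so that each extends the previous one,
because two of them differ by a sign. -/
lemma Meromorphic.exists_sq_eq {F : ℂ → ℂ} (hF : Meromorphic F)
    (hev : ∀ a, ∃ n : ℤ, meromorphicOrderAt F a = ((2 * n : ℤ) : WithTop ℤ)) :
    ∃ g : ℂ → ℂ, MeromorphicNFOn g Set.univ ∧ ∀ a, ∀ᶠ z in 𝓝[≠] a, g z ^ 2 = F z := by
  let S (n : ℕ) := {g : ℂ → ℂ // MeromorphicNFOn g (Metric.ball 0 (n + 1)) ∧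
      ∀ a ∈ Metric.ball (0 : ℂ) (n + 1), ∀ᶠ z in 𝓝[≠] a, g z ^ 2 = F z}
  have step : ∀ (n : ℕ) (g : S n), ∃ k : S (n + 1), ∀ z ∈ Metric.ball (0 : ℂ) (n + 1),
      k.1 z = g.1 z := by
    rintro n ⟨g, hg, hg2⟩
    obtain ⟨k, hk, hk2⟩ := hF.exists_sq_eq_on_ball hev (R := ((n + 1 : ℕ) : ℝ) + 1) (by positivity)
    have hsub : Metric.ball (0 : ℂ) (n + 1) ⊆ Metric.ball 0 (((n + 1 : ℕ) : ℝ) + 1) :=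
      Metric.ball_subset_ball (by push_cast; linarith)
    rcases MeromorphicNFOn.eqOn_or_eqOn_neg (convex_ball (0 : ℂ) ((n : ℝ) + 1)).isPreconnected
      (fun z hz => hk (hsub hz)) hg (fun a ha => by
        filter_upwards [hg2 a ha, hk2 a (hsub ha)] with z h1 h2
        rw [h1, h2]) with h | h
    · exact ⟨⟨k, hk, hk2⟩, h⟩
    · refine ⟨⟨fun z => -k z, fun z hz => ?_, fun a ha => ?_⟩, fun z hz => ?_⟩
      · have := (hk hz).smul_analytic (analyticAt_const (v := (-1 : ℂ))) (by norm_num)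
        convert this using 1
        ext; simp
      · simpa using hk2 a ha
      · simp [h z hz]
  choose nxt hnxt using step
  obtain ⟨g0, hg0⟩ := hF.exists_sq_eq_on_ball hev (R := ((0 : ℕ) : ℝ) + 1) (by positivity)
  let G : ∀ n, S n := fun n => Nat.rec ⟨g0, hg0⟩ nxt n
  have hG : ∀ n m : ℕ, n ≤ m → ∀ z ∈ Metric.ball (0 : ℂ) (n + 1), (G m).1 z = (G n).1 z := by
    intro n m hnm
    induction m, hnm using Nat.le_induction with
    | base => exact fun z _ => rfl
    | succ m hm ih =>
      intro z hz
      rw [← ih z hz]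
      refine hnxt m (G m) z (Metric.ball_subset_ball ?_ hz)
      have : (n : ℝ) ≤ m := by exact_mod_cast hm
      linarith
  -- hence `z ↦ G ⌈‖z‖⌉₊ z` agrees with `G n` on the whole disc of radius `n + 1`
  have hloc : ∀ (n : ℕ), ∀ z ∈ Metric.ball (0 : ℂ) (n + 1), (G ⌈‖z‖⌉₊).1 z = (G n).1 z := by
    intro n z hz
    rcases le_total n ⌈‖z‖⌉₊ with h | h
    · exact hG _ _ h z hz
    · refine (hG _ _ h z ?_).symm
      rw [mem_ball_zero_iff]
      have := Nat.le_ceil ‖z‖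
      linarith
  have hmem : ∀ a : ℂ, a ∈ Metric.ball (0 : ℂ) ((⌈‖a‖⌉₊ : ℝ) + 1) := by
    intro a
    rw [mem_ball_zero_iff]
    have := Nat.le_ceil ‖a‖
    linarith
  have hev' : ∀ a : ℂ, (fun z => (G ⌈‖z‖⌉₊).1 z) =ᶠ[𝓝 a] (G ⌈‖a‖⌉₊).1 := fun a =>
    Filter.eventually_of_mem (Metric.isOpen_ball.mem_nhds (hmem a)) fun z hz => hloc _ z hz
  refine ⟨fun z => (G ⌈‖z‖⌉₊).1 z, fun a _ => ?_, fun a => ?_⟩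
  · exact (meromorphicNFAt_congr (hev' a)).2 ((G ⌈‖a‖⌉₊).2.1 (hmem a))
  · filter_upwards [(hev' a).filter_mono nhdsWithin_le_nhds, (G ⌈‖a‖⌉₊).2.2 a (hmem a)] with z h1 h2
    rw [h1, h2]

/-! ### Values of the Weierstrass function -/

/-- Uniqueness for the linear equation `w'' = q w` with analytic coefficient: a nonzero solution
with vanishing initial data would have an order `n ≥ 2`, but then the two sides have the orders
`n - 2` and at least `n`. -/
lemma eventually_eq_zero_of_second_order {w q : ℂ → ℂ} {a : ℂ} (hw : AnalyticAt ℂ w a)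
    (hq : AnalyticAt ℂ q a) (h : ∀ᶠ x in 𝓝 a, deriv (deriv w) x = q x * w x)
    (h0 : w a = 0) (h1 : deriv w a = 0) : ∀ᶠ x in 𝓝 a, w x = 0 := by
  by_contra hne
  have hne' : ¬ ∀ᶠ x in 𝓝[≠] a, w x = 0 := by
    rw [← hw.frequently_zero_iff_eventually_zero] at hne
    exact fun h => hne h.frequently
  have htop : meromorphicOrderAt w a ≠ ⊤ := fun h => hne' (meromorphicOrderAt_eq_top_iff.1 h)
  obtain ⟨n, hn⟩ := WithTop.ne_top_iff_exists.1 htop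
  have hpos : ∀ (f : ℂ → ℂ), AnalyticAt ℂ f a → f a = 0 → 0 < meromorphicOrderAt f a := by
    intro f hf hf0
    rw [← tendsto_zero_iff_meromorphicOrderAt_pos hf.meromorphicAt, ← hf0]
    exact hf.continuousAt.tendsto.mono_left nhdsWithin_le_nhds
  have hn0 : 0 < n := by simpa [← hn] using hpos w hw h0
  have hd1 : meromorphicOrderAt (deriv w) a = ((n - 1 : ℤ) : WithTop ℤ) :=
    meromorphicOrderAt_deriv_eq_sub_one (by exact_mod_cast hn0.ne') hn.symm
  have hn1 : 0 < n - 1 := by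
    have := hpos _ hw.deriv h1
    rw [hd1] at this
    exact_mod_cast this
  have hd2 : meromorphicOrderAt (deriv (deriv w)) a = ((n - 1 - 1 : ℤ) : WithTop ℤ) :=
    meromorphicOrderAt_deriv_eq_sub_one (by exact_mod_cast hn1.ne') hd1
  have h3 : deriv (deriv w) =ᶠ[𝓝[≠] a] q * w := h.filter_mono nhdsWithin_le_nhds
  rw [meromorphicOrderAt_congr h3, meromorphicOrderAt_mul hq.meromorphicAt hw.meromorphicAt,
    ← hn] at hd2
  have hq0 := hq.meromorphicOrderAt_nonneg
  cases hqo : meromorphicOrderAt q a with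
  | top =>
    rw [hqo, top_add] at hd2
    exact WithTop.top_ne_coe hd2
  | coe k =>
    rw [hqo] at hd2 hq0
    have h4 : k + n = n - 1 - 1 := by exact_mod_cast hd2
    have h5 : 0 ≤ k := by exact_mod_cast hq0
    omega

namespace PeriodPair

variable (L : PeriodPair)

lemma analyticAt_weierstrassP {x : ℂ} (hx : x ∉ L.lattice) : AnalyticAt ℂ L.weierstrassP x :=
  L.analyticOnNhd_weierstrassP x hx

lemma weierstrassP_add_of_mem {x l : ℂ} (hl : l ∈ L.lattice) :
    L.weierstrassP (x + l) = L.weierstrassP x :=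
  L.weierstrassP_add_coe x ⟨l, hl⟩

lemma isPreconnected_compl_lattice : IsPreconnected ((L.lattice : Set ℂ)ᶜ) := by
  have : (L.lattice : Set ℂ).Countable := by
    have : Countable L.lattice := L.latticeEquivProd.toEquiv.countable_iff.2 inferInstance
    exact Set.to_countable _
  exact (this.isPathConnected_compl_of_one_lt_rank (by simp)).isConnected.isPreconnected

/-- `℘` is not constant near any point. -/
lemma not_eventually_derivWeierstrassP_eq_zero {a : ℂ} (ha : a ∉ L.lattice) :
    ¬ ∀ᶠ x in 𝓝 a, L.derivWeierstrassP x = 0 := by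
  intro h
  have h1 : Set.EqOn L.derivWeierstrassP 0 ((L.lattice : Set ℂ)ᶜ) :=
    L.analyticOnNhd_derivWeierstrassP.eqOn_zero_of_preconnected_of_eventuallyEq_zero
      L.isPreconnected_compl_lattice ha h
  have hev : ∀ᶠ x in 𝓝[≠] (0 : ℂ), x ∉ L.lattice := by
    filter_upwards [self_mem_nhdsWithin,
      mem_nhdsWithin_of_mem_nhds (L.compl_lattice_sdiff_singleton_mem_nhds 0)] with w hw hw'
    exact fun hm => hw' ⟨hm, hw⟩
  have h2 : meromorphicOrderAt L.derivWeierstrassP 0 = ⊤ :=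
    meromorphicOrderAt_eq_top_iff.2 (hev.mono fun x hx => h1 hx)
  have h3 := meromorphicOrderAt_deriv_eq_sub_one (f := L.weierstrassP) (x := 0) (n := -2)
    (by norm_num) (by rw [L.order_weierstrassP 0 (zero_mem _)]; rfl)
  rw [L.deriv_weierstrassP, h2] at h3
  exact absurd h3 (WithTop.top_ne_coe)

/-- The second order equation of `℘`, obtained from the first order one by differentiation and by
cancelling `℘'`, which vanishes on no open set. -/
lemma deriv_derivWeierstrassP {x : ℂ} (hx : x ∉ L.lattice) :
    deriv L.derivWeierstrassP x = 6 * L.weierstrassP x ^ 2 - L.g₂ / 2 := by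
  have hP := L.analyticOnNhd_weierstrassP
  have hP' := L.analyticOnNhd_derivWeierstrassP
  have hprod : ∀ y ∈ ((L.lattice : Set ℂ)ᶜ), L.derivWeierstrassP y *
      (deriv L.derivWeierstrassP y - (6 * L.weierstrassP y ^ 2 - L.g₂ / 2)) = 0 := by
    intro y hy
    have d1 := (hP' y hy).differentiableAt.hasDerivAt
    have d0 := (hP y hy).differentiableAt.hasDerivAt
    rw [L.deriv_weierstrassP] at d0
    have e1 : (fun z => L.derivWeierstrassP z ^ 2) =ᶠ[𝓝 y] fun z =>
        4 * L.weierstrassP z ^ 3 - L.g₂ * L.weierstrassP z - L.g₃ := by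
      filter_upwards [L.isClosed_lattice.isOpen_compl.mem_nhds hy] with z hz
      exact L.derivWeierstrassP_sq z hz
    have e2 := e1.deriv_eq
    rw [(d1.fun_pow 2).deriv,
      ((((d0.fun_pow 3).const_mul 4).fun_sub (d0.const_mul L.g₂)).sub_const L.g₃).deriv] at e2
    push_cast at e2
    linear_combination e2 / 2
  have han : AnalyticOnNhd ℂ (fun y => deriv L.derivWeierstrassP y -
      (6 * L.weierstrassP y ^ 2 - L.g₂ / 2)) ((L.lattice : Set ℂ)ᶜ) := by
    intro y hy
    have := hP y hy
    have := (hP' y hy).deriv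
    fun_prop
  rcases hP'.eq_zero_or_eq_zero_of_mul_eq_zero han hprod L.isPreconnected_compl_lattice with h | h
  · exact absurd (Filter.eventually_of_mem (L.isClosed_lattice.isOpen_compl.mem_nhds hx) h)
      (L.not_eventually_derivWeierstrassP_eq_zero hx)
  · exact sub_eq_zero.1 (h x hx)

/-- `℘` is determined up to translation by a lattice vector by its initial data at one point: the
difference of the translates `℘(x + a)` and `℘(x + b)` solves a linear second order equation with
vanishing initial data, so the translates coincide and have the same poles. -/
lemma sub_mem_lattice_of_weierstrassP_eq {a b : ℂ} (ha : a ∉ L.lattice) (hb : b ∉ L.lattice)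
    (h : L.weierstrassP a = L.weierstrassP b)
    (h' : L.derivWeierstrassP a = L.derivWeierstrassP b) : a - b ∈ L.lattice := by
  have hP := L.analyticOnNhd_weierstrassP
  have hP' := L.analyticOnNhd_derivWeierstrassP
  have shift : ∀ c y : ℂ, y + c ∉ L.lattice →
      HasDerivAt (fun x => L.weierstrassP (x + c)) (L.derivWeierstrassP (y + c)) y := by
    intro c y hy
    have d0 := (hP _ hy).differentiableAt.hasDerivAt
    rw [L.deriv_weierstrassP] at d0
    exact d0.comp_add_const y c
  have shift' : ∀ c y : ℂ, y + c ∉ L.lattice → HasDerivAt (fun x => L.derivWeierstrassP (x + c))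
      (6 * L.weierstrassP (y + c) ^ 2 - L.g₂ / 2) y := by
    intro c y hy
    have d0 := (hP' _ hy).differentiableAt.hasDerivAt
    rw [L.deriv_derivWeierstrassP hy] at d0
    exact d0.comp_add_const y c
  have hopen : ∀ c : ℂ, c ∉ L.lattice → ∀ᶠ y in 𝓝 (0 : ℂ), y + c ∉ L.lattice := by
    intro c hc
    have : Tendsto (fun y : ℂ => y + c) (𝓝 0) (𝓝 c) := by
      simpa using (continuous_id.add_const c).tendsto (0 : ℂ)
    exact this.eventually (L.isClosed_lattice.isOpen_compl.mem_nhds hc)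
  have hsh : ∀ c : ℂ, c ∉ L.lattice → AnalyticAt ℂ (fun x => L.weierstrassP (x + c)) 0 := by
    intro c hc
    have : AnalyticAt ℂ L.weierstrassP (0 + c) := by rw [zero_add]; exact hP c hc
    exact this.fun_comp (f := fun x : ℂ => x + c) (by fun_prop)
  have hz : ∀ᶠ x in 𝓝 (0 : ℂ), L.weierstrassP (x + a) - L.weierstrassP (x + b) = 0 := by
    have e1 : ∀ᶠ y in 𝓝 (0 : ℂ), deriv (fun x => L.weierstrassP (x + a) - L.weierstrassP (x + b)) y
        = L.derivWeierstrassP (y + a) - L.derivWeierstrassP (y + b) := by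
      filter_upwards [hopen a ha, hopen b hb] with y h1 h2
      exact ((shift a y h1).fun_sub (shift b y h2)).deriv
    refine eventually_eq_zero_of_second_order
      (q := fun x => 6 * (L.weierstrassP (x + a) + L.weierstrassP (x + b)))
      ((hsh a ha).sub (hsh b hb)) (by have := hsh a ha; have := hsh b hb; fun_prop) ?_
      (by simp [h]) (by rw [e1.self_of_nhds]; simp [h'])
    filter_upwards [e1.eventually_nhds, hopen a ha, hopen b hb] with y e h1 h2
    rw [EventuallyEq.deriv_eq e, ((shift' a y h1).fun_sub (shift' b y h2)).deriv]
    ring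
  -- by the identity theorem the two translates have the same order at `-b`, where one has a pole
  have hm : ∀ c : ℂ, Meromorphic fun x => L.weierstrassP (x + c) := fun c x =>
    (L.meromorphic_weierstrassP (x + c)).comp_analyticAt (f := L.weierstrassP)
      (g := fun x : ℂ => x + c) (by fun_prop)
  have hmd : MeromorphicOn (fun x => L.weierstrassP (x + a) - L.weierstrassP (x + b)) Set.univ :=
    fun x _ => (hm a x).sub (hm b x)
  have htop : meromorphicOrderAt (fun x => L.weierstrassP (x + a) - L.weierstrassP (x + b)) (-b)
      = ⊤ := by
    by_contra hne
    refine hmd.meromorphicOrderAt_ne_top_of_isPreconnected (x := -b) (y := 0)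
      isPreconnected_univ trivial trivial hne ?_
    exact meromorphicOrderAt_eq_top_iff.2 (hz.filter_mono nhdsWithin_le_nhds)
  have heq : (fun x => L.weierstrassP (x + a)) =ᶠ[𝓝[≠] (-b)] fun x => L.weierstrassP (x + b) :=
    (meromorphicOrderAt_eq_top_iff.1 htop).mono fun x hx => sub_eq_zero.1 hx
  have hord := meromorphicOrderAt_congr heq
  have hcomp : ∀ c y : ℂ, meromorphicOrderAt (fun x => L.weierstrassP (x + c)) y
      = meromorphicOrderAt L.weierstrassP (y + c) := fun c y =>
    meromorphicOrderAt_comp_add_const_eq_meromorphicOrderAt (f := L.weierstrassP)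
  rw [hcomp, hcomp, neg_add_cancel, L.order_weierstrassP 0 (zero_mem _)] at hord
  by_contra hab
  have : -b + a ∉ L.lattice := by rwa [neg_add_eq_sub]
  have hnn := (hP _ this).meromorphicOrderAt_nonneg
  rw [hord] at hnn
  exact absurd hnn (by decide)

/-- `℘` takes a value only at points which are congruent up to sign. -/
lemma sub_mem_or_add_mem_of_weierstrassP_eq {a b : ℂ} (ha : a ∉ L.lattice) (hb : b ∉ L.lattice)
    (h : L.weierstrassP a = L.weierstrassP b) : a - b ∈ L.lattice ∨ a + b ∈ L.lattice := by
  have h2 : L.derivWeierstrassP a ^ 2 = L.derivWeierstrassP b ^ 2 := by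
    rw [L.derivWeierstrassP_sq a ha, L.derivWeierstrassP_sq b hb, h]
  rcases sq_eq_sq_iff_eq_or_eq_neg.1 h2 with h3 | h3
  · exact Or.inl (L.sub_mem_lattice_of_weierstrassP_eq ha hb h h3)
  · right
    have := L.sub_mem_lattice_of_weierstrassP_eq (b := -b) ha (by rwa [neg_mem_iff])
      (by simpa using h) (by simpa using h3)
    simpa using this

/-- The zeros of `℘'` are the half periods. -/
lemma derivWeierstrassP_ne_zero {a : ℂ} (ha : 2 * a ∉ L.lattice) : L.derivWeierstrassP a ≠ 0 := by
  intro h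
  have ha' : a ∉ L.lattice := fun h => ha (by rw [two_mul]; exact add_mem h h)
  have := L.sub_mem_lattice_of_weierstrassP_eq (b := -a) ha' (by rwa [neg_mem_iff])
    (by simp) (by simp [h])
  exact ha (by simpa [two_mul] using this)

/-- The double pole of `℘` has leading coefficient `1`. -/
lemma tendsto_sub_sq_mul_weierstrassP {a : ℂ} (ha : a ∈ L.lattice) :
    Tendsto (fun x => (x - a) ^ 2 * L.weierstrassP x) (𝓝[≠] a) (𝓝 1) := by
  have hc : ContinuousAt (fun z => (z - a) ^ 2 * L.weierstrassPExcept a z + 1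
      - (z - a) ^ 2 / a ^ 2) a := by
    have := (L.analyticAt_weierstrassPExcept a).continuousAt
    fun_prop
  have h := hc.tendsto.mono_left (nhdsWithin_le_nhds (s := {a}ᶜ))
  simp only [sub_self, ne_eq, OfNat.ofNat_ne_zero, not_false_eq_true, zero_pow, zero_mul, zero_add,
    zero_div, sub_zero] at h
  refine h.congr' ?_
  filter_upwards [self_mem_nhdsWithin] with z hz
  rw [← L.ite_eq_one_sub_sq_mul_weierstrassP a ha z, if_neg (by simpa using hz)]

/-- Translates of the lattice have no accumulation points. -/
lemma eventually_add_notMem_lattice (a c : ℂ) : ∀ᶠ x in 𝓝[≠] a, x + c ∉ L.lattice := by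
  have h : ∀ᶠ y in 𝓝 (a + c), y ∉ (L.lattice : Set ℂ) \ {a + c} :=
    L.compl_lattice_sdiff_singleton_mem_nhds (a + c)
  have ht : Tendsto (fun x : ℂ => x + c) (𝓝 a) (𝓝 (a + c)) := (continuous_id.add_const c).tendsto a
  filter_upwards [(ht.eventually h).filter_mono nhdsWithin_le_nhds, self_mem_nhdsWithin]
    with x hx hxa
  exact fun hm => hx ⟨hm, fun he => hxa (by simpa using he)⟩

lemma countable_setOf_add_mem_lattice (c : ℂ) : {x | x + c ∈ L.lattice}.Countable := by
  have : Countable L.lattice := L.latticeEquivProd.toEquiv.countable_iff.2 inferInstance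
  have h : (L.lattice : Set ℂ).Countable := Set.to_countable _
  exact h.preimage_of_injOn (f := fun x => x + c) fun x _ y _ h => by simpa using h

lemma half_combination_mem_lattice_iff {p q : ℤ} :
    (p : ℂ) * (L.ω₁ / 2) + q * (L.ω₂ / 2) ∈ L.lattice ↔ 2 ∣ p ∧ 2 ∣ q := by
  rw [mem_lattice]
  constructor
  · rintro ⟨m, n, h⟩
    have := LinearIndependent.pair_iff.mp L.indep (2 * m - p) (2 * n - q)
      (by simp only [Complex.real_smul]; push_cast; linear_combination 2 * h)
    obtain ⟨h1, h2⟩ := this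
    have h1' : 2 * m = p := by exact_mod_cast sub_eq_zero.1 h1
    have h2' : 2 * n = q := by exact_mod_cast sub_eq_zero.1 h2
    exact ⟨⟨m, h1'.symm⟩, ⟨n, h2'.symm⟩⟩
  · rintro ⟨⟨m, rfl⟩, ⟨n, rfl⟩⟩
    exact ⟨m, n, by push_cast; ring⟩

end PeriodPair

namespace EllipticParams

variable (P : EllipticParams)

/-! ### The half periods and the singular set -/

lemma two_mul_ω_mem (i : Fin 4) : 2 * P.ω i ∈ P.lattice.lattice := by
  fin_cases i
  · simp [ω]
  · simpa [ω, mul_div_cancel₀] using P.lattice.ω₁_mem_lattice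
  · have := neg_mem (add_mem P.lattice.ω₁_mem_lattice P.lattice.ω₂_mem_lattice)
    convert this using 1
    simp [ω]; ring
  · simpa [ω, mul_div_cancel₀] using P.lattice.ω₂_mem_lattice

lemma ω_sub_ω_mem_iff (i j : Fin 4) : P.ω i - P.ω j ∈ P.lattice.lattice ↔ i = j := by
  have key : ∀ p q : ℤ, P.ω i - P.ω j = p * (P.lattice.ω₁ / 2) + q * (P.lattice.ω₂ / 2) →
      (P.ω i - P.ω j ∈ P.lattice.lattice ↔ 2 ∣ p ∧ 2 ∣ q) := fun p q h => by
    rw [h, P.lattice.half_combination_mem_lattice_iff]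
  -- in the coordinates `A`, `B` of the four half periods, membership is a parity check
  let A : Fin 4 → ℤ := ![0, 1, -1, 0]
  let B : Fin 4 → ℤ := ![0, 0, -1, 1]
  have hω : ∀ k, P.ω k = A k * (P.lattice.ω₁ / 2) + B k * (P.lattice.ω₂ / 2) := by
    intro k
    fin_cases k <;> simp [ω, A, B]
    ring
  rw [key (A i - A j) (B i - B j) (by rw [hω i, hω j]; push_cast; ring)]
  clear key
  revert i j
  decide

lemma mem_halfLattice_iff {x : ℂ} : x ∈ P.halfLattice ↔ ∃ k, x + P.ω k ∈ P.lattice.lattice := by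
  constructor
  · intro h
    obtain ⟨m, n, hmn⟩ := PeriodPair.mem_lattice.1 h
    have key : ∀ (p q : ℤ) (k : Fin 4),
        P.ω k = p * (P.lattice.ω₁ / 2) + q * (P.lattice.ω₂ / 2) → 2 ∣ m + p → 2 ∣ n + q →
        ∃ k, x + P.ω k ∈ P.lattice.lattice := by
      intro p q k hk h1 h2
      refine ⟨k, ?_⟩
      have := P.lattice.half_combination_mem_lattice_iff.2 ⟨h1, h2⟩
      convert this using 1
      rw [hk]; push_cast; linear_combination -hmn / 2
    rcases Int.even_or_odd m with ⟨a, rfl⟩ | ⟨a, rfl⟩ <;>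
      rcases Int.even_or_odd n with ⟨b, rfl⟩ | ⟨b, rfl⟩
    · exact key 0 0 0 (by simp [ω]) (by omega) (by omega)
    · exact key 0 1 3 (by simp [ω]) (by omega) (by omega)
    · exact key 1 0 1 (by simp [ω]) (by omega) (by omega)
    · exact key (-1) (-1) 2 (by simp [ω, sub_eq_add_neg]) (by omega) (by omega)
  · rintro ⟨k, hk⟩
    have h1 := P.lattice.lattice.smul_mem (2 : ℤ) hk
    have h2 := sub_mem h1 (P.two_mul_ω_mem k)
    change 2 * x ∈ P.lattice.lattice
    convert h2 using 1
    simp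

lemma mem_sing_iff {x : ℂ} : x ∈ P.sing ↔ (∃ k, x + P.ω k ∈ P.lattice.lattice) ∨
    ∃ i, x - P.δ i ∈ P.lattice.lattice ∨ x + P.δ i ∈ P.lattice.lattice := by
  rw [← mem_halfLattice_iff]; rfl

lemma eventually_notMem_sing (a : ℂ) : ∀ᶠ x in 𝓝[≠] a, x ∉ P.sing := by
  have h1 : ∀ᶠ x in 𝓝[≠] a, ∀ k, x + P.ω k ∉ P.lattice.lattice :=
    eventually_all.2 fun k => P.lattice.eventually_add_notMem_lattice a _
  have h2 : ∀ᶠ x in 𝓝[≠] a, ∀ i, x + -P.δ i ∉ P.lattice.lattice :=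
    eventually_all.2 fun k => P.lattice.eventually_add_notMem_lattice a _
  have h3 : ∀ᶠ x in 𝓝[≠] a, ∀ i, x + P.δ i ∉ P.lattice.lattice :=
    eventually_all.2 fun k => P.lattice.eventually_add_notMem_lattice a _
  filter_upwards [h1, h2, h3] with x h1 h2 h3
  rw [mem_sing_iff]
  rintro (⟨k, hk⟩ | ⟨i, hi | hi⟩)
  · exact h1 k hk
  · exact h2 i (by rwa [← sub_eq_add_neg])
  · exact h3 i hi

lemma isOpen_compl_sing : IsOpen P.singᶜ := by
  rw [isOpen_iff_mem_nhds]
  intro a ha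
  rw [← nhdsNE_sup_pure a]
  exact ⟨P.eventually_notMem_sing a, ha⟩

/-- The complement of a countable set in the plane is connected. -/
lemma isPreconnected_compl_sing : IsPreconnected P.singᶜ := by
  have hc : P.sing.Countable := by
    have : P.sing ⊆ (⋃ k, {x | x + P.ω k ∈ P.lattice.lattice}) ∪
        ((⋃ i, {x | x + -P.δ i ∈ P.lattice.lattice}) ∪
          ⋃ i, {x | x + P.δ i ∈ P.lattice.lattice}) := by
      intro x hx
      rcases P.mem_sing_iff.1 hx with ⟨k, hk⟩ | ⟨i, hi | hi⟩
      · exact Or.inl (Set.mem_iUnion.2 ⟨k, hk⟩)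
      · exact Or.inr (Or.inl (Set.mem_iUnion.2 ⟨i, by simpa [← sub_eq_add_neg] using hi⟩))
      · exact Or.inr (Or.inr (Set.mem_iUnion.2 ⟨i, hi⟩))
    refine Set.Countable.mono this ?_
    exact (Set.countable_iUnion fun k => P.lattice.countable_setOf_add_mem_lattice _).union
      ((Set.countable_iUnion fun k => P.lattice.countable_setOf_add_mem_lattice _).union
        (Set.countable_iUnion fun k => P.lattice.countable_setOf_add_mem_lattice _))
  exact (hc.isPathConnected_compl_of_one_lt_rank (by simp)).isConnected.isPreconnected

lemma notMem_lattice_of_notMem_sing {x : ℂ} (hx : x ∉ P.sing) : x ∉ P.lattice.lattice :=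
  fun h => hx (P.mem_sing_iff.2 (Or.inl ⟨0, by simpa [ω] using h⟩))

lemma add_mem_sing_iff {x c : ℂ} (hc : c ∈ P.lattice.lattice) : x + c ∈ P.sing ↔ x ∈ P.sing := by
  have h : ∀ y, y + c ∈ P.lattice.lattice ↔ y ∈ P.lattice.lattice := fun y =>
    Submodule.add_mem_iff_left _ hc
  simp only [mem_sing_iff, add_right_comm x c, add_sub_right_comm x c, h]

lemma neg_mem_sing_iff {x : ℂ} : -x ∈ P.sing ↔ x ∈ P.sing := by
  suffices h : ∀ x, x ∈ P.sing → -x ∈ P.sing from ⟨fun hx => by simpa using h _ hx, h x⟩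
  intro x hx
  rcases hx with hx | ⟨i, hi | hi⟩
  · left
    change 2 * -x ∈ P.lattice.lattice
    rw [mul_neg]
    exact neg_mem hx
  · exact Or.inr ⟨i, Or.inr (by convert neg_mem hi using 1; ring)⟩
  · exact Or.inr ⟨i, Or.inl (by convert neg_mem hi using 1; ring)⟩

/-! ### The potential -/

lemma wp_add_of_mem {x c : ℂ} (hc : c ∈ P.lattice.lattice) : P.wp (x + c) = P.wp x :=
  P.lattice.weierstrassP_add_of_mem hc

@[simp] lemma wp_neg (x : ℂ) : P.wp (-x) = P.wp x := P.lattice.weierstrassP_neg x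

lemma v_neg (x : ℂ) : P.v (-x) = P.v x := by
  have h1 : ∀ i, P.wp (-x + P.ω i) = P.wp (x + P.ω i) := fun i => by
    rw [← P.wp_neg, ← P.wp_add_of_mem (P.two_mul_ω_mem i)]
    congr 1; ring
  have h2 : ∀ i, P.wp (-x - P.δ i) = P.wp (x + P.δ i) := fun i => by
    rw [← P.wp_neg]; congr 1; ring
  have h3 : ∀ i, P.wp (-x + P.δ i) = P.wp (x - P.δ i) := fun i => by
    rw [← P.wp_neg]; congr 1; ring
  simp only [v, h1, h2, h3, wp_neg]
  congr 1
  exact Finset.sum_congr rfl fun i _ => by ring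

variable {P}

lemma Admissible.δ_notMem (hP : P.Admissible) (i : Fin P.M) : P.δ i ∉ P.lattice.lattice := fun h =>
  hP.two_mul_δ_notMem i (by rw [two_mul]; exact add_mem h h)

/-- The zeros of `℘ - ℘(δ i)` are congruent to `± δ i`. -/
lemma Admissible.wp_sub_ne_zero (hP : P.Admissible) {x : ℂ} (i : Fin P.M)
    (hx : x ∉ P.lattice.lattice) (h1 : x - P.δ i ∉ P.lattice.lattice)
    (h2 : x + P.δ i ∉ P.lattice.lattice) : P.wp x - P.wp (P.δ i) ≠ 0 := fun h =>
  (P.lattice.sub_mem_or_add_mem_of_weierstrassP_eq hx (hP.δ_notMem i) (sub_eq_zero.1 h)).elim h1 h2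

variable (P) in
lemma analyticAt_wp_comp {x : ℂ} (c : ℂ) (hx : x + c ∉ P.lattice.lattice) :
    AnalyticAt ℂ (fun y => P.wp (y + c)) x :=
  (P.lattice.analyticAt_weierstrassP hx).fun_comp (f := fun y : ℂ => y + c) (by fun_prop)

variable (P) in
lemma analyticAt_wp {x : ℂ} (hx : x ∉ P.lattice.lattice) : AnalyticAt ℂ P.wp x :=
  P.lattice.analyticAt_weierstrassP hx

lemma Admissible.analyticAt_v (hP : P.Admissible) {x : ℂ} (hx : x ∉ P.sing) :
    AnalyticAt ℂ P.v x := by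
  have hx' := hx
  rw [mem_sing_iff] at hx'
  push Not at hx'
  obtain ⟨h1, h2⟩ := hx'
  have hxl := P.notMem_lattice_of_notMem_sing hx
  refine AnalyticAt.fun_add (Finset.analyticAt_fun_sum _ fun i _ => ?_)
    (Finset.analyticAt_fun_sum _ fun i _ => ?_)
  · exact analyticAt_const.mul (P.analyticAt_wp_comp _ (h1 i))
  · have a1 := P.analyticAt_wp_comp (P.δ i) (h2 i).2
    have a2 := P.analyticAt_wp_comp (x := x) (-P.δ i) (by rw [← sub_eq_add_neg]; exact (h2 i).1)
    simp only [← sub_eq_add_neg] at a2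
    exact (analyticAt_const.mul (a2.add a1)).add (analyticAt_const.div
      ((P.analyticAt_wp hxl).sub analyticAt_const) (hP.wp_sub_ne_zero i hxl (h2 i).1 (h2 i).2))

variable (P) in
lemma meromorphic_wp : Meromorphic P.wp := P.lattice.meromorphic_weierstrassP

variable (P) in
lemma wp_eq_of_congr {x y : ℂ} (h : x - y ∈ P.lattice.lattice ∨ x + y ∈ P.lattice.lattice) :
    P.wp x = P.wp y := by
  rcases h with h | h
  · rw [← P.wp_add_of_mem (x := y) h]; congr 1; ring
  · rw [← P.wp_neg y, ← P.wp_add_of_mem (x := -y) h]; congr 1; ring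

open Classical in
/-- The order of `℘ - ℘(δ i)`: a double pole at the lattice, simple zeros at `± δ i`. -/
lemma Admissible.order_wp_sub (hP : P.Admissible) (i : Fin P.M) (a : ℂ) :
    meromorphicOrderAt (fun x => P.wp x - P.wp (P.δ i)) a =
      (((if a ∈ P.lattice.lattice then -2 else
        if a - P.δ i ∈ P.lattice.lattice ∨ a + P.δ i ∈ P.lattice.lattice then 1 else 0 : ℤ)) :
          WithTop ℤ) := by
  split_ifs with h1 h2
  · have h3 : meromorphicOrderAt P.wp a = -2 := P.lattice.order_weierstrassP a h1
    have := meromorphicOrderAt_add_eq_left_of_lt (f₁ := P.wp) (f₂ := fun _ => -P.wp (P.δ i))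
      (x := a) (MeromorphicAt.const _ _) (by
        rw [h3]
        exact lt_of_lt_of_le (by decide) (analyticAt_const.meromorphicOrderAt_nonneg))
    simp only [sub_eq_add_neg]
    exact this.trans h3
  · have hwp : P.wp a = P.wp (P.δ i) := P.wp_eq_of_congr h2
    have h2a : 2 * a ∉ P.lattice.lattice := by
      intro h
      apply hP.two_mul_δ_notMem i
      rcases h2 with h2 | h2
      · have := sub_mem h (add_mem h2 h2)
        convert this using 1; ring
      · have := sub_mem (add_mem h2 h2) h
        convert this using 1; ring
    have ha := P.analyticAt_wp h1
    have hd : deriv P.wp a ≠ 0 := by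
      have := P.lattice.derivWeierstrassP_ne_zero h2a
      rwa [← P.lattice.deriv_weierstrassP] at this
    have := ha.analyticOrderAt_sub_eq_one_of_deriv_ne_zero hd
    rw [hwp] at this
    rw [AnalyticAt.meromorphicOrderAt_eq (ha.fun_sub analyticAt_const), this]
    rfl
  · have ha := P.analyticAt_wp h1
    push Not at h2
    rw [AnalyticAt.meromorphicOrderAt_eq (ha.fun_sub analyticAt_const),
      AnalyticAt.analyticOrderAt_eq_zero (ha.fun_sub analyticAt_const) |>.2
        (hP.wp_sub_ne_zero i h1 h2.1 h2.2)]
    rfl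

open Classical in
lemma tendsto_sub_sq_mul_wp_add (a c : ℂ) :
    Tendsto (fun x => (x - a) ^ 2 * P.wp (x + c)) (𝓝[≠] a)
      (𝓝 (if a + c ∈ P.lattice.lattice then 1 else 0)) := by
  split_ifs with h
  · have h1 := P.lattice.tendsto_sub_sq_mul_weierstrassP h
    have h2 : Tendsto (fun x : ℂ => x + c) (𝓝[≠] a) (𝓝[≠] (a + c)) := by
      refine tendsto_nhdsWithin_iff.2 ⟨((continuous_id.add_const c).tendsto a).mono_left
        nhdsWithin_le_nhds, ?_⟩
      filter_upwards [self_mem_nhdsWithin] with x hx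
      simpa using hx
    refine (h1.comp h2).congr fun x => ?_
    simp [wp]
  · have h1 : ContinuousAt (fun x => (x - a) ^ 2 * P.wp (x + c)) a := by
      have := (P.analyticAt_wp_comp c h).continuousAt
      fun_prop
    simpa using h1.tendsto.mono_left (nhdsWithin_le_nhds (s := {a}ᶜ))

/-- The terms `s / (℘ - ℘(δ))` of the potential have at most simple poles. -/
lemma Admissible.tendsto_sub_sq_mul_div (hP : P.Admissible) (i : Fin P.M) (a : ℂ) :
    Tendsto (fun x => (x - a) ^ 2 * (P.s i / (P.wp x - P.wp (P.δ i)))) (𝓝[≠] a) (𝓝 0) := by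
  have hm : MeromorphicAt (fun x => P.wp x - P.wp (P.δ i)) a :=
    (P.meromorphic_wp a).sub (MeromorphicAt.const _ _)
  have hsq : MeromorphicAt (fun x : ℂ => (x - a) ^ 2) a := by fun_prop
  have h1 : Tendsto ((fun x => (x - a) ^ 2) * (fun x => P.wp x - P.wp (P.δ i))⁻¹) (𝓝[≠] a)
      (𝓝 0) := by
    apply tendsto_zero_of_meromorphicOrderAt_pos
    have hsq' : meromorphicOrderAt (fun x : ℂ => (x - a) ^ 2) a = ((2 : ℤ) : WithTop ℤ) :=
      fun_meromorphicOrderAt_pow_id_sub_const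
    rw [meromorphicOrderAt_mul hsq hm.inv, meromorphicOrderAt_inv, hP.order_wp_sub i a, hsq']
    split_ifs <;> decide
  have h2 := h1.const_mul (P.s i)
  rw [mul_zero] at h2
  refine h2.congr fun x => ?_
  simp only [Pi.mul_apply, Pi.inv_apply]
  ring

open Classical in
/-- The coefficient of the double pole of the potential at an arbitrary point. The last summand `0`
is the contribution of `s i / (℘ - ℘(δ i))`. -/
lemma Admissible.tendsto_sub_sq_mul_v (hP : P.Admissible) (a : ℂ) :
    Tendsto (fun x => (x - a) ^ 2 * P.v x) (𝓝[≠] a)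
      (𝓝 (∑ i : Fin 4, (P.l i : ℂ) * (P.l i + 1) * (if a + P.ω i ∈ P.lattice.lattice then 1 else 0)
        + ∑ i : Fin P.M, ((P.r i : ℂ) / 2 * (P.r i / 2 + 1) *
          ((if a - P.δ i ∈ P.lattice.lattice then 1 else 0)
            + (if a + P.δ i ∈ P.lattice.lattice then 1 else 0)) + 0))) := by
  have h1 := tendsto_finsetSum Finset.univ fun (i : Fin 4) _ =>
    (tendsto_sub_sq_mul_wp_add (P := P) a (P.ω i)).const_mul ((P.l i : ℂ) * (P.l i + 1))
  have h2 := tendsto_finsetSum Finset.univ fun (i : Fin P.M) _ =>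
    ((((tendsto_sub_sq_mul_wp_add (P := P) a (-P.δ i)).add
      (tendsto_sub_sq_mul_wp_add (P := P) a (P.δ i))).const_mul
        ((P.r i : ℂ) / 2 * (P.r i / 2 + 1))).add (hP.tendsto_sub_sq_mul_div i a))
  simp only [← sub_eq_add_neg] at h2
  refine (h1.add h2).congr fun x => ?_
  rw [v, mul_add, Finset.mul_sum, Finset.mul_sum]
  congr 1
  · exact Finset.sum_congr rfl fun i _ => by ring
  · exact Finset.sum_congr rfl fun i _ => by ring

lemma Admissible.tendsto_sub_sq_mul_v_of_notMem_sing (hP : P.Admissible) {a : ℂ} (ha : a ∉ P.sing) :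
    Tendsto (fun x => (x - a) ^ 2 * P.v x) (𝓝[≠] a) (𝓝 0) := by
  have hc : ContinuousAt (fun x => (x - a) ^ 2 * P.v x) a := by
    have := (hP.analyticAt_v ha).continuousAt
    fun_prop
  simpa using hc.tendsto.mono_left (nhdsWithin_le_nhds (s := {a}ᶜ))

lemma Admissible.half_period_add_δ_notMem (hP : P.Admissible) {a : ℂ} (i : Fin P.M)
    (ha : a ∈ P.halfLattice) : a - P.δ i ∉ P.lattice.lattice ∧ a + P.δ i ∉ P.lattice.lattice := by
  have ha' : 2 * a ∈ P.lattice.lattice := ha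
  constructor <;> intro h <;> apply hP.two_mul_δ_notMem i
  · convert sub_mem ha' (add_mem h h) using 1; ring
  · convert sub_mem (add_mem h h) ha' using 1; ring

lemma Admissible.tendsto_sub_sq_mul_v_half_period (hP : P.Admissible) {a : ℂ} {k : Fin 4}
    (ha : a + P.ω k ∈ P.lattice.lattice) :
    Tendsto (fun x => (x - a) ^ 2 * P.v x) (𝓝[≠] a) (𝓝 ((P.l k : ℂ) * (P.l k + 1))) := by
  classical
  have hha : a ∈ P.halfLattice := P.mem_halfLattice_iff.2 ⟨k, ha⟩
  have h := hP.tendsto_sub_sq_mul_v a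
  have h1 : ∀ i, a + P.ω i ∈ P.lattice.lattice ↔ i = k := fun i => by
    rw [← P.ω_sub_ω_mem_iff i k]
    constructor
    · intro h; convert sub_mem h ha using 1; ring
    · intro h; convert add_mem h ha using 1; ring
  have h2 := fun i => (hP.half_period_add_δ_notMem i hha).1
  have h3 := fun i => (hP.half_period_add_δ_notMem i hha).2
  simpa [h1, h2, h3] using h

lemma Admissible.eq_of_congr_δ (hP : P.Admissible) {a : ℂ} {i j : Fin P.M}
    (hi : a - P.δ i ∈ P.lattice.lattice ∨ a + P.δ i ∈ P.lattice.lattice)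
    (hj : a - P.δ j ∈ P.lattice.lattice ∨ a + P.δ j ∈ P.lattice.lattice) : i = j :=
  hP.b_injective ((P.wp_eq_of_congr hi).symm.trans (P.wp_eq_of_congr hj))

lemma Admissible.tendsto_sub_sq_mul_v_δ (hP : P.Admissible) {a : ℂ} {j : Fin P.M}
    (ha : a - P.δ j ∈ P.lattice.lattice ∨ a + P.δ j ∈ P.lattice.lattice) :
    Tendsto (fun x => (x - a) ^ 2 * P.v x) (𝓝[≠] a)
      (𝓝 ((P.r j : ℂ) / 2 * (P.r j / 2 + 1))) := by
  classical
  have h := hP.tendsto_sub_sq_mul_v a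
  have hha : a ∉ P.halfLattice := fun hh =>
    ha.elim (hP.half_period_add_δ_notMem j hh).1 (hP.half_period_add_δ_notMem j hh).2
  have h1 : ∀ i, a + P.ω i ∉ P.lattice.lattice := fun i hi => hha (P.mem_halfLattice_iff.2 ⟨i, hi⟩)
  have hij : ∀ i, (a - P.δ i ∈ P.lattice.lattice ∨ a + P.δ i ∈ P.lattice.lattice) → i = j :=
    fun i hi => hP.eq_of_congr_δ hi ha
  have hsum : ∀ i, ((if a - P.δ i ∈ P.lattice.lattice then 1 else 0)
      + (if a + P.δ i ∈ P.lattice.lattice then 1 else 0) : ℂ) = if i = j then 1 else 0 := by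
    intro i
    by_cases hi : i = j
    · subst hi
      have hnot : ¬ (a - P.δ i ∈ P.lattice.lattice ∧ a + P.δ i ∈ P.lattice.lattice) := by
        rintro ⟨h1, h2⟩
        apply hP.two_mul_δ_notMem i
        convert sub_mem h2 h1 using 1; ring
      rcases ha with h1 | h1
      · have h2 : a + P.δ i ∉ P.lattice.lattice := fun h2 => hnot ⟨h1, h2⟩
        simp [h1, h2]
      · have h2 : a - P.δ i ∉ P.lattice.lattice := fun h2 => hnot ⟨h2, h1⟩
        simp [h1, h2]
    · have h2 : a - P.δ i ∉ P.lattice.lattice := fun h2 => hi (hij i (Or.inl h2))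
      have h3 : a + P.δ i ∉ P.lattice.lattice := fun h2 => hi (hij i (Or.inr h2))
      simp [h2, h3, hi]
  simp only [hsum, h1, if_false] at h
  simpa using h

/-! ### The square of `Ψ_g` -/

variable (P) in
/-- The single-valued square `Ψ_g ^ 2 = ∏ i, (℘ - ℘(δ i)) ^ r i`. -/
def psiSq (y : ℂ) : ℂ := ∏ i : Fin P.M, (P.wp y - P.wp (P.δ i)) ^ P.r i

variable (P) in
lemma psiSq_neg (y : ℂ) : P.psiSq (-y) = P.psiSq y := by simp [psiSq]

variable (P) in
lemma psiSq_add_of_mem {x c : ℂ} (hc : c ∈ P.lattice.lattice) : P.psiSq (x + c) = P.psiSq x := by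
  simp [psiSq, P.wp_add_of_mem hc]

variable (P) in
lemma meromorphic_psiSq : Meromorphic P.psiSq := fun x =>
  MeromorphicAt.fun_prod fun _ _ => ((P.meromorphic_wp x).sub (MeromorphicAt.const _ _)).pow _

variable (P) in
lemma analyticAt_psiSq {x : ℂ} (hx : x ∉ P.lattice.lattice) : AnalyticAt ℂ P.psiSq x :=
  Finset.analyticAt_fun_prod _ fun _ _ => ((P.analyticAt_wp hx).sub analyticAt_const).pow _

lemma Admissible.psiSq_ne_zero (hP : P.Admissible) {x : ℂ} (hx : x ∉ P.sing) : P.psiSq x ≠ 0 := by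
  have hxl := P.notMem_lattice_of_notMem_sing hx
  rw [mem_sing_iff] at hx
  push Not at hx
  exact Finset.prod_ne_zero_iff.2 fun i _ =>
    pow_ne_zero _ (hP.wp_sub_ne_zero i hxl (hx.2 i).1 (hx.2 i).2)

open Classical in
lemma Admissible.order_psiSq (hP : P.Admissible) (a : ℂ) :
    meromorphicOrderAt P.psiSq a = ((∑ i, P.r i * (if a ∈ P.lattice.lattice then -2 else
        if a - P.δ i ∈ P.lattice.lattice ∨ a + P.δ i ∈ P.lattice.lattice then 1 else 0) : ℤ) :
          WithTop ℤ) := by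
  have hm : ∀ i, MeromorphicAt (fun x => P.wp x - P.wp (P.δ i)) a := fun i =>
    (P.meromorphic_wp a).sub (MeromorphicAt.const _ _)
  have h1 : meromorphicOrderAt P.psiSq a
      = ∑ i, meromorphicOrderAt (fun x => (P.wp x - P.wp (P.δ i)) ^ P.r i) a :=
    meromorphicOrderAt_fun_prod fun _ _ => (hm _).pow _
  rw [h1, WithTop.coe_sum]
  refine Finset.sum_congr rfl fun i _ => ?_
  rw [fun_meromorphicOrderAt_pow (hm i), hP.order_wp_sub i a]
  rfl

/-! ### The first integral is constant -/

/-- The derivative of the first integral is `Ξ / 2` times the left-hand side of the third order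
equation. -/
lemma Admissible.exists_Qexpr_eq (hP : P.Admissible) {X : ℂ → ℂ} (hX : X ∈ P.evenPeriodicSol) :
    ∃ Q : ℂ, ∀ x ∉ P.sing, P.Qexpr X x = Q := by
  obtain ⟨-, han, -, -, -, -, hode⟩ := hX
  have hd : ∀ x ∈ P.singᶜ, HasDerivAt (P.Qexpr X) 0 x := by
    intro x hx
    have a0 := han x hx
    have d0 := a0.differentiableAt.hasDerivAt
    have d1 := a0.deriv.differentiableAt.hasDerivAt
    have d2 := a0.deriv.deriv.differentiableAt.hasDerivAt
    have dv := (hP.analyticAt_v hx).differentiableAt.hasDerivAt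
    have e := hode x hx
    simp only [iteratedDeriv_succ, iteratedDeriv_zero] at e
    have h := (((d0.fun_pow 2).fun_mul (dv.const_sub P.E)).fun_add
      ((d0.const_mul (1 / 2)).fun_mul d2)).fun_sub ((d1.fun_pow 2).const_mul (1 / 4))
    have hfun : P.Qexpr X = fun x => X x ^ 2 * (P.E - P.v x) + 1 / 2 * X x * deriv (deriv X) x
        - 1 / 4 * deriv X x ^ 2 := by
      funext y
      simp only [Qexpr, iteratedDeriv_succ, iteratedDeriv_zero]
    rw [hfun]
    refine h.congr_deriv ?_
    push_cast
    linear_combination (X x / 2) * e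
  have hc {x y : ℂ} (hx : x ∈ P.singᶜ) (hy : y ∈ P.singᶜ) : P.Qexpr X x = P.Qexpr X y :=
    P.isOpen_compl_sing.is_const_of_deriv_eq_zero P.isPreconnected_compl_sing
      (fun x hx => (hd x hx).differentiableAt.differentiableWithinAt)
      (fun x hx => (hd x hx).deriv) hx hy
  obtain ⟨x₀, hx₀⟩ := (P.eventually_notMem_sing 0).exists
  exact ⟨P.Qexpr X x₀, fun x hx => hc hx hx₀⟩

/-! ### Solutions of the second order equation -/

/-- `Ψ_g` has holomorphic branches away from the singular set, where `Ψ_g ^ 2` has no zeros. -/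
lemma Admissible.exists_branch (hP : P.Admissible) {x : ℂ} (hx : x ∉ P.sing) :
    ∃ ψ, P.IsBranchPsi ψ x := by
  obtain ⟨ψ, h1, h2⟩ := (P.analyticAt_psiSq (P.notMem_lattice_of_notMem_sing hx)).exists_sq_eq
    (hP.psiSq_ne_zero hx)
  exact ⟨ψ, h1, h2⟩

lemma IsBranchPsi.sq_eq {ψ : ℂ → ℂ} {x : ℂ} (h : P.IsBranchPsi ψ x) : ψ x ^ 2 = P.psiSq x :=
  h.2.self_of_nhds

lemma IsBranchPsi.eventually {ψ : ℂ → ℂ} {x : ℂ} (h : P.IsBranchPsi ψ x) :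
    ∀ᶠ y in 𝓝 x, P.IsBranchPsi ψ y :=
  h.1.eventually_analyticAt.and h.2.eventually_nhds

lemma IsBranchPsi.ne_zero {ψ : ℂ → ℂ} {x : ℂ} (h : P.IsBranchPsi ψ x) (hP : P.Admissible)
    (hx : x ∉ P.sing) : ψ x ≠ 0 := fun h0 =>
  hP.psiSq_ne_zero hx (by rw [← h.sq_eq, h0]; ring)

lemma IsBranchPsi.comp_neg {ψ : ℂ → ℂ} {x : ℂ} (h : P.IsBranchPsi ψ x) :
    P.IsBranchPsi (fun y => ψ (-y)) (-x) := by
  have ht : Tendsto (fun y : ℂ => -y) (𝓝 (-x)) (𝓝 x) := by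
    simpa using (continuous_neg (G := ℂ)).tendsto (-x)
  refine ⟨?_, ?_⟩
  · have : AnalyticAt ℂ ψ (- -x) := by rw [neg_neg]; exact h.1
    exact this.fun_comp (f := fun y : ℂ => -y) (by fun_prop)
  · filter_upwards [ht.eventually h.2] with y hy
    simpa using hy

variable (P) in
/-- `g = f Ψ_g` for a solution `f` of `(H - E) f = 0` on the complement of the singular set, which
is multiplied by the constants `ε₁`, `ε₃` under translation by the periods. -/
structure IsSol (ε₁ ε₃ : ℂ) (g : ℂ → ℂ) : Prop where
  meromorphic : Meromorphic g
  analyticAt : ∀ x ∉ P.sing, AnalyticAt ℂ g x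
  add_two_mul_ω_one : ∀ x ∉ P.sing, g (x + 2 * P.ω 1) = ε₁ * g x
  add_two_mul_ω_three : ∀ x ∉ P.sing, g (x + 2 * P.ω 3) = ε₃ * g x
  solves : ∀ x ∉ P.sing, P.SolvesHAt g x

lemma IsSol.comp_neg {ε₁ ε₃ : ℂ} {g : ℂ → ℂ} (hg : P.IsSol ε₁ ε₃ g) (h₁ : ε₁ ^ 2 = 1)
    (h₃ : ε₃ ^ 2 = 1) : P.IsSol ε₁ ε₃ fun x => g (-x) := by
  have hper : ∀ {ε c : ℂ}, c ∈ P.lattice.lattice → ε ^ 2 = 1 →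
      (∀ x ∉ P.sing, g (x + c) = ε * g x) → ∀ x ∉ P.sing, g (-(x + c)) = ε * g (-x) := by
    intro ε c hc hε h x hx
    have hx' : -(x + c) ∉ P.sing := by rwa [P.neg_mem_sing_iff, P.add_mem_sing_iff hc]
    have := h _ hx'
    rw [show -(x + c) + c = -x by ring] at this
    rw [this]
    linear_combination -(g (-(x + c))) * hε
  refine ⟨fun x => ?_, fun x hx => ?_, hper (P.two_mul_ω_mem 1) h₁ hg.add_two_mul_ω_one,
    hper (P.two_mul_ω_mem 3) h₃ hg.add_two_mul_ω_three, fun x hx ψ hψ => ?_⟩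
  · exact (hg.meromorphic (-x)).comp_analyticAt (g := fun y : ℂ => -y) (by fun_prop)
  · exact (hg.analyticAt (-x) (by rwa [P.neg_mem_sing_iff])).fun_comp (f := fun y : ℂ => -y)
      (by fun_prop)
  · have h := hg.solves (-x) (by rwa [P.neg_mem_sing_iff]) _ hψ.comp_neg
    have h2 := iteratedDeriv_comp_neg 2 (fun y => g y / ψ (-y)) x
    simp only [neg_neg, even_two, Even.neg_pow, one_pow, one_smul] at h2 h
    rw [h2, ← P.v_neg]
    exact h

lemma IsSol.analyticAt_div {ε₁ ε₃ : ℂ} {g ψ : ℂ → ℂ} (hg : P.IsSol ε₁ ε₃ g) (hP : P.Admissible)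
    {x : ℂ} (hx : x ∉ P.sing) (hψ : P.IsBranchPsi ψ x) : AnalyticAt ℂ (fun y => g y / ψ y) x :=
  (hg.analyticAt x hx).div hψ.1 (hψ.ne_zero hP hx)

lemma IsSol.eventually_iteratedDeriv_two {ε₁ ε₃ : ℂ} {g ψ : ℂ → ℂ} (hg : P.IsSol ε₁ ε₃ g)
    {x : ℂ} (hx : x ∉ P.sing) (hψ : P.IsBranchPsi ψ x) :
    ∀ᶠ y in 𝓝 x, iteratedDeriv 2 (fun y => g y / ψ y) y = (P.v y - P.E) * (g y / ψ y) := by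
  filter_upwards [hψ.eventually, P.isOpen_compl_sing.mem_nhds hx] with y hy hys
  linear_combination -(hg.solves y hys ψ hy)

lemma IsSol.add {ε₁ ε₃ : ℂ} {g k : ℂ → ℂ} (hP : P.Admissible) (hg : P.IsSol ε₁ ε₃ g)
    (hk : P.IsSol ε₁ ε₃ k) : P.IsSol ε₁ ε₃ fun x => g x + k x := by
  refine ⟨fun x => (hg.meromorphic x).add (hk.meromorphic x),
    fun x hx => (hg.analyticAt x hx).add (hk.analyticAt x hx), fun x hx => ?_, fun x hx => ?_,
    fun x hx ψ hψ => ?_⟩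
  · rw [hg.add_two_mul_ω_one x hx, hk.add_two_mul_ω_one x hx, mul_add]
  · rw [hg.add_two_mul_ω_three x hx, hk.add_two_mul_ω_three x hx, mul_add]
  · have h1 := hg.solves x hx ψ hψ
    have h2 := hk.solves x hx ψ hψ
    simp only [add_div]
    rw [iteratedDeriv_fun_add (hg.analyticAt_div hP hx hψ).contDiffAt
      (hk.analyticAt_div hP hx hψ).contDiffAt]
    linear_combination h1 + h2

variable (P) in
open Classical in
/-- The product `f(x) f(-x)`, where `f = g / Ψ_g`, with the value `0` on the singular set. -/
def symmProd (g : ℂ → ℂ) (x : ℂ) : ℂ := if x ∈ P.sing then 0 else g x * g (-x) / P.psiSq x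

lemma symmProd_of_notMem (g : ℂ → ℂ) {x : ℂ} (hx : x ∉ P.sing) :
    P.symmProd g x = g x * g (-x) / P.psiSq x := if_neg hx

/-- For every solution `f` with multipliers `± 1` the product `f(x) f(-x)` is an even elliptic
solution of the third order equation. -/
lemma IsSol.symmProd_mem {ε₁ ε₃ : ℂ} {g : ℂ → ℂ} (hP : P.Admissible) (hg : P.IsSol ε₁ ε₃ g)
    (h₁ : ε₁ ^ 2 = 1) (h₃ : ε₃ ^ 2 = 1) : P.symmProd g ∈ P.evenPeriodicSol := by
  have hn := hg.comp_neg h₁ h₃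
  have hper : ∀ {ε c : ℂ}, c ∈ P.lattice.lattice → ε ^ 2 = 1 →
      (∀ x ∉ P.sing, g (x + c) = ε * g x) → (∀ x ∉ P.sing, g (-(x + c)) = ε * g (-x)) →
      ∀ x, P.symmProd g (x + c) = P.symmProd g x := by
    intro ε c hc hε h h' x
    by_cases hx : x ∈ P.sing
    · rw [symmProd, if_pos ((P.add_mem_sing_iff hc).2 hx), symmProd, if_pos hx]
    · rw [symmProd_of_notMem g hx, symmProd_of_notMem g (by rwa [P.add_mem_sing_iff hc]), h x hx,
        h' x hx, P.psiSq_add_of_mem hc]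
      congr 1
      linear_combination g x * g (-x) * hε
  have hev : ∀ x ∉ P.sing, P.symmProd g =ᶠ[𝓝 x] fun y => g y * g (-y) / P.psiSq y := fun x hx => by
    filter_upwards [P.isOpen_compl_sing.mem_nhds hx] with y hy
    exact symmProd_of_notMem g hy
  refine ⟨fun x => ?_, fun x hx => ?_, fun x hx => if_pos hx, fun x => ?_,
    hper (P.two_mul_ω_mem 1) h₁ hg.add_two_mul_ω_one hn.add_two_mul_ω_one,
    hper (P.two_mul_ω_mem 3) h₃ hg.add_two_mul_ω_three hn.add_two_mul_ω_three, fun x hx => ?_⟩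
  · refine (((hg.meromorphic x).mul (hn.meromorphic x)).div (P.meromorphic_psiSq x)).congr ?_
    filter_upwards [P.eventually_notMem_sing x] with y hy
    exact (symmProd_of_notMem g hy).symm
  · exact (((hg.analyticAt x hx).mul (hn.analyticAt x hx)).div
      (P.analyticAt_psiSq (P.notMem_lattice_of_notMem_sing hx)) (hP.psiSq_ne_zero hx)).congr
      (hev x hx).symm
  · by_cases hx : x ∈ P.sing
    · rw [symmProd, if_pos (P.neg_mem_sing_iff.2 hx), symmProd, if_pos hx]
    · rw [symmProd_of_notMem g hx, symmProd_of_notMem g (by rwa [P.neg_mem_sing_iff]), neg_neg,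
        P.psiSq_neg, mul_comm]
  · obtain ⟨ψ, hψ⟩ := hP.exists_branch hx
    have h := third_order_of_mul (hg.analyticAt_div hP hx hψ) (hn.analyticAt_div hP hx hψ)
      ((hP.analyticAt_v hx).differentiableAt.sub_const P.E)
      (hg.eventually_iteratedDeriv_two hx hψ) (hn.eventually_iteratedDeriv_two hx hψ)
    have he : P.symmProd g =ᶠ[𝓝 x] fun y => g y / ψ y * (g (-y) / ψ y) := by
      filter_upwards [hev x hx, hψ.eventually] with y hy hy2
      rw [hy, ← hy2.sq_eq, div_mul_div_comm, sq]
    rw [he.iteratedDeriv_eq, he.deriv_eq, h, he.self_of_nhds, deriv_sub_const]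
    ring

/-- An element of `𝓕̃` that solves the equation, as identities on the complement of the singular
set. -/
lemma isSol_of_mem_tildeF {ε₁ ε₃ : ℂ} {g : ℂ → ℂ} (hg : g ∈ P.tildeF ε₁ ε₃)
    (hs : ∀ x ∉ P.sing, P.SolvesHAt g x) : P.IsSol ε₁ ε₃ g := by
  obtain ⟨⟨hm, hp1, hp3⟩, han, -, -⟩ := hg
  have ha : ∀ x ∉ P.sing, AnalyticAt ℂ g x := fun x hx => han x fun h => hx (Or.inl h)
  have hper : ∀ {ε c : ℂ}, c ∈ P.lattice.lattice → (∀ᶠ x in codiscrete ℂ, g (x + c) = ε * g x) →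
      ∀ x ∉ P.sing, g (x + c) = ε * g x := by
    intro ε c hc h x hx
    have h1 : ∀ᶠ y in 𝓝[≠] x, g (y + c) = ε * g y := by
      have := mem_codiscreteWithin_iff_forall_mem_nhdsNE.1 h x (Set.mem_univ x)
      filter_upwards [this] with y hy
      exact hy.resolve_right fun h => h trivial
    have a1 : AnalyticAt ℂ (fun y => g (y + c)) x :=
      (ha (x + c) (by rwa [P.add_mem_sing_iff hc])).fun_comp (f := fun y : ℂ => y + c) (by fun_prop)
    have a2 : AnalyticAt ℂ (fun y => ε * g y) x := analyticAt_const.mul (ha x hx)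
    exact ((a1.frequently_eq_iff_eventually_eq a2).1 h1.frequently).self_of_nhds
  exact ⟨hm, ha, hper (P.two_mul_ω_mem 1) hp1, hper (P.two_mul_ω_mem 3) hp3, hs⟩

/-- If the space of even elliptic solutions of the third order equation is one-dimensional, a
solution `f` with multipliers `± 1` is proportional to `f(-x)`: the symmetric products of
`f(x) + f(-x)` and of `f(x)` are proportional, and this is a quadratic equation for
`f(x) / f(-x)` with constant coefficients. -/
lemma IsSol.exists_eq_mul_comp_neg {ε₁ ε₃ : ℂ} {g : ℂ → ℂ} (hP : P.Admissible)
    (hdim : Module.finrank ℂ P.evenPeriodicSol = 1) (hg : P.IsSol ε₁ ε₃ g) (h₁ : ε₁ ^ 2 = 1)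
    (h₃ : ε₃ ^ 2 = 1) (hne : P.symmProd g ≠ 0) : ∃ α : ℂ, ∀ x ∉ P.sing, g x = α * g (-x) := by
  have hn := hg.comp_neg h₁ h₃
  have hmem := hg.symmProd_mem hP h₁ h₃
  have hmem2 := (hg.add hP hn).symmProd_mem hP h₁ h₃
  obtain ⟨c, hc⟩ := (finrank_eq_one_iff_of_nonzero' (⟨_, hmem⟩ : P.evenPeriodicSol)
    (fun h => hne (congrArg Subtype.val h))).1 hdim ⟨_, hmem2⟩
  have hc' : ∀ x ∉ P.sing, c * (g x * g (-x)) = (g x + g (-x)) * (g (-x) + g x) := by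
    intro x hx
    have h := congrFun (congrArg Subtype.val hc) x
    simp only [SetLike.mk_smul_mk, Pi.smul_apply, smul_eq_mul, symmProd_of_notMem _ hx,
      neg_neg] at h
    have h0 := hP.psiSq_ne_zero hx
    field_simp at h
    linear_combination h
  -- `(c - 2 ± d) / 2` are the roots of `t ^ 2 - (c - 2) * t + 1`
  obtain ⟨d, hd⟩ := IsAlgClosed.exists_pow_nat_eq ((c - 2) ^ 2 - 4) (n := 2) (by norm_num)
  have hfac : ∀ x ∈ P.singᶜ, (g x - ((c - 2 + d) / 2) * g (-x)) *
      (g x - ((c - 2 - d) / 2) * g (-x)) = 0 := by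
    intro x hx
    linear_combination -(hc' x hx) - (g (-x)) ^ 2 / 4 * hd
  have han : ∀ β : ℂ, AnalyticOnNhd ℂ (fun x => g x - β * g (-x)) P.singᶜ := fun β x hx =>
    (hg.analyticAt x hx).sub (analyticAt_const.mul (hn.analyticAt x hx))
  rcases (han _).eq_zero_or_eq_zero_of_mul_eq_zero (han _) hfac P.isPreconnected_compl_sing with
    h | h
  · exact ⟨_, fun x hx => sub_eq_zero.1 (h x hx)⟩
  · exact ⟨_, fun x hx => sub_eq_zero.1 (h x hx)⟩

lemma IsSol.symmProd_ne_zero {ε₁ ε₃ : ℂ} {g : ℂ → ℂ} (hP : P.Admissible) (hg : P.IsSol ε₁ ε₃ g)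
    (h₁ : ε₁ ^ 2 = 1) (h₃ : ε₃ ^ 2 = 1) (hne : ∃ x ∉ P.sing, g x ≠ 0) : P.symmProd g ≠ 0 := by
  intro h0
  obtain ⟨x₀, hx₀, hgx⟩ := hne
  have hmul : ∀ x ∈ P.singᶜ, g x * g (-x) = 0 := by
    intro x hx
    have h := congrFun h0 x
    rw [symmProd_of_notMem g hx] at h
    simpa [hP.psiSq_ne_zero hx] using h
  rcases AnalyticOnNhd.eq_zero_or_eq_zero_of_mul_eq_zero (U := P.singᶜ)
    (fun x hx => hg.analyticAt x hx) (fun x hx => (hg.comp_neg h₁ h₃).analyticAt x hx) hmul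
    P.isPreconnected_compl_sing with h | h
  · exact hgx (h x₀ hx₀)
  · have := h (-x₀) fun h' => hx₀ (P.neg_mem_sing_iff.1 h')
    exact hgx (by simpa using this)

/-- A solution `f` with multipliers `± 1` forces the first integral to vanish, since every even
elliptic solution of the third order equation is then a multiple of `f ^ 2`. -/
lemma IsSol.Qexpr_eq_zero {ε₁ ε₃ : ℂ} {g : ℂ → ℂ} (hP : P.Admissible)
    (hdim : Module.finrank ℂ P.evenPeriodicSol = 1) (hg : P.IsSol ε₁ ε₃ g) (h₁ : ε₁ ^ 2 = 1)
    (h₃ : ε₃ ^ 2 = 1) (hne : ∃ x ∉ P.sing, g x ≠ 0) {X : ℂ → ℂ} (hX : X ∈ P.evenPeriodicSol)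
    {x : ℂ} (hx : x ∉ P.sing) : P.Qexpr X x = 0 := by
  have hne' := hg.symmProd_ne_zero hP h₁ h₃ hne
  obtain ⟨α, hα⟩ := hg.exists_eq_mul_comp_neg hP hdim h₁ h₃ hne'
  obtain ⟨c, hc⟩ := (finrank_eq_one_iff_of_nonzero' (⟨_, hg.symmProd_mem hP h₁ h₃⟩ :
    P.evenPeriodicSol) (fun h => hne' (congrArg Subtype.val h))).1 hdim ⟨X, hX⟩
  obtain ⟨κ, hκ⟩ := IsAlgClosed.exists_pow_nat_eq (c * α) (n := 2) (by norm_num)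
  obtain ⟨ψ, hψ⟩ := hP.exists_branch hx
  have he : X =ᶠ[𝓝 x] fun y => (κ * (g y / ψ y)) ^ 2 := by
    filter_upwards [P.isOpen_compl_sing.mem_nhds hx, hψ.eventually] with y hy hy2
    have h := congrFun (congrArg Subtype.val hc) y
    simp only [SetLike.mk_smul_mk, Pi.smul_apply, smul_eq_mul, symmProd_of_notMem _ hy] at h
    have hα' := hα (-y) (by rwa [P.neg_mem_sing_iff])
    rw [neg_neg] at hα'
    rw [← h, hα', mul_pow, hκ, div_pow, hy2.sq_eq]
    ring
  have ha := hg.analyticAt_div hP hx hψ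
  have h := first_integral_sq
    (analyticAt_const.fun_mul ha : AnalyticAt ℂ (fun y => κ * (g y / ψ y)) x)
    (P.E - P.v x)
  rw [Qexpr, he.iteratedDeriv_eq, he.deriv_eq, he.self_of_nhds, h, iteratedDeriv_const_mul_field,
    (hg.eventually_iteratedDeriv_two hx hψ).self_of_nhds]
  ring

/-! ### Construction of a solution when the first integral vanishes -/

/-- A nonzero `Ξ` vanishes identically near no point, because its domain is connected. -/
lemma order_ne_top_of_mem {X : ℂ → ℂ} (hX : X ∈ P.evenPeriodicSol) (hX0 : X ≠ 0) (a : ℂ) :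
    meromorphicOrderAt X a ≠ ⊤ := by
  obtain ⟨hm, han, hz, -⟩ := hX
  obtain ⟨x₀, hx₀⟩ := Function.ne_iff.1 hX0
  have hxs : x₀ ∉ P.sing := fun h => hx₀ (hz x₀ h)
  have hmo : MeromorphicOn X Set.univ := fun x _ => hm x
  refine hmo.meromorphicOrderAt_ne_top_of_isPreconnected (x := x₀) isPreconnected_univ trivial
    trivial ?_
  rw [meromorphicOrderAt_ne_top_iff_eventually_ne_zero (hm x₀)]
  exact ((han x₀ hxs).continuousAt.eventually_ne hx₀).filter_mono nhdsWithin_le_nhds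

/-- The two exponents `l + 2` and `-l` have the same parity as `l`. -/
lemma eq_or_eq_of_indicial {m l : ℤ} (h : m * (m - 2) = l * (l + 2)) : m = l + 2 ∨ m = -l := by
  have : (m - (l + 2)) * (m + l) = 0 := by linear_combination h
  rcases mul_eq_zero.1 this with h | h
  · left; omega
  · right; omega

/-- If the first integral of `X` vanishes then `X Ψ_g ^ 2` has even order at every point. The
bounds on half of that order are those in the definition of `𝓕̃`. -/
lemma Admissible.exists_order_mul_psiSq (hP : P.Admissible) {X : ℂ → ℂ}
    (hX : X ∈ P.evenPeriodicSol) (hX0 : X ≠ 0) (hQ : ∀ x ∉ P.sing, P.Qexpr X x = 0) (a : ℂ) :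
    ∃ n : ℤ, meromorphicOrderAt (fun x => X x * P.psiSq x) a = ((2 * n : ℤ) : WithTop ℤ) ∧
      (a ∉ P.halfLattice → 0 ≤ n) ∧
      (∀ k ≠ 0, a + P.ω k ∈ P.lattice.lattice → -(P.l k : ℤ) ≤ n) ∧
      (a ∈ P.lattice.lattice → -((P.l 0 : ℤ) + ∑ i, (P.r i : ℤ)) ≤ n) := by
  classical
  have hm : Meromorphic X := hX.1
  obtain ⟨m, hm'⟩ := WithTop.ne_top_iff_exists.1 (order_ne_top_of_mem hX hX0 a)
  have hQ' : ∀ᶠ x in 𝓝[≠] a, X x ^ 2 * (P.E - P.v x) + 1 / 2 * X x * iteratedDeriv 2 X x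
      - 1 / 4 * deriv X x ^ 2 = 0 := (P.eventually_notMem_sing a).mono hQ
  have hind : ∀ (c : ℂ) (l : ℤ), Tendsto (fun x => (x - a) ^ 2 * P.v x) (𝓝[≠] a) (𝓝 c) →
      4 * c = l * (l + 2) → m = l + 2 ∨ m = -l := by
    intro c l hc hl
    have h := order_mul_order_sub_two_of_first_integral_zero (hm a) hm'.symm hc hQ'
    rw [hl] at h
    exact eq_or_eq_of_indicial (by exact_mod_cast h)
  have hord : meromorphicOrderAt (fun x => X x * P.psiSq x) a
      = (m : WithTop ℤ) + meromorphicOrderAt P.psiSq a := by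
    rw [hm']
    exact meromorphicOrderAt_mul (hm a) (P.meromorphic_psiSq a)
  rw [hP.order_psiSq a, ← WithTop.coe_add] at hord
  by_cases hhalf : a ∈ P.halfLattice
  · obtain ⟨k, hk⟩ := P.mem_halfLattice_iff.1 hhalf
    have huniq : ∀ j, a + P.ω j ∈ P.lattice.lattice → j = k := fun j hj => by
      rw [← P.ω_sub_ω_mem_iff]
      convert sub_mem hj hk using 1; ring
    have h0 : a ∈ P.lattice.lattice ↔ k = 0 := by
      constructor
      · exact fun h => (huniq 0 (by simpa [ω] using h)).symm
      · rintro rfl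
        simpa [ω] using hk
    have hmk := hind _ (2 * P.l k) (hP.tendsto_sub_sq_mul_v_half_period hk) (by push_cast; ring)
    -- at the lattice points the pole of `Ψ_g ^ 2` contributes `-2 * ∑ i, r i`
    by_cases hk0 : k = 0
    · subst hk0
      have ha := h0.2 rfl
      simp only [ha, if_true, ← Finset.sum_mul] at hord
      rcases hmk with h | h
      · refine ⟨P.l 0 + 1 - ∑ i, (P.r i : ℤ), ?_, fun h => absurd hhalf h,
          fun j hj hj' => absurd (huniq j hj') hj, fun _ => ?_⟩
        · rw [hord, h]; congr 1; ring
        · have : (0 : ℤ) ≤ P.l 0 := by positivity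
          linarith
      · refine ⟨-P.l 0 - ∑ i, (P.r i : ℤ), ?_, fun h => absurd hhalf h,
          fun j hj hj' => absurd (huniq j hj') hj, fun _ => ?_⟩
        · rw [hord, h]; congr 1; ring
        · linarith
    · have ha : a ∉ P.lattice.lattice := fun h => hk0 (h0.1 h)
      have hδ := fun i => hP.half_period_add_δ_notMem i hhalf
      simp only [ha, (hδ _).1, (hδ _).2, or_self, if_false, mul_zero, Finset.sum_const_zero,
        add_zero] at hord
      rcases hmk with h | h
      · refine ⟨P.l k + 1, ?_, fun h => absurd hhalf h, fun j hj hj' => ?_, fun h => absurd h ha⟩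
        · rw [hord, h]; congr 1
        · obtain rfl := huniq j hj'
          have : (0 : ℤ) ≤ P.l j := by positivity
          linarith
      · refine ⟨-P.l k, ?_, fun h => absurd hhalf h, fun j hj hj' => ?_, fun h => absurd h ha⟩
        · rw [hord, h]; congr 1; ring
        · obtain rfl := huniq j hj'
          exact le_rfl
  · have hω : ∀ k, a + P.ω k ∉ P.lattice.lattice := fun k hk =>
      hhalf (P.mem_halfLattice_iff.2 ⟨k, hk⟩)
    have ha : a ∉ P.lattice.lattice := fun h => hω 0 (by simpa [ω] using h)
    suffices h : ∃ n : ℤ,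
        meromorphicOrderAt (fun x => X x * P.psiSq x) a = ((2 * n : ℤ) : WithTop ℤ) ∧ 0 ≤ n by
      obtain ⟨n, hn, hn0⟩ := h
      exact ⟨n, hn, fun _ => hn0, fun k _ hk => absurd hk (hω k), fun h => absurd h ha⟩
    rw [hord]
    by_cases hδ : ∃ j, a - P.δ j ∈ P.lattice.lattice ∨ a + P.δ j ∈ P.lattice.lattice
    · obtain ⟨j, hj⟩ := hδ
      have hij : ∀ i, (a - P.δ i ∈ P.lattice.lattice ∨ a + P.δ i ∈ P.lattice.lattice) ↔ i = j :=
        fun i => ⟨fun hi => hP.eq_of_congr_δ hi hj, fun h => h ▸ hj⟩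
      simp only [ha, hij, if_false, mul_ite, mul_one, mul_zero, Finset.sum_ite_eq',
        Finset.mem_univ, if_true]
      rcases hind _ (P.r j) (hP.tendsto_sub_sq_mul_v_δ hj) (by push_cast; ring) with h | h
      · exact ⟨P.r j + 1, by rw [h]; congr 1; ring, by positivity⟩
      · exact ⟨0, by rw [h]; congr 1; ring, le_rfl⟩
    · push Not at hδ
      simp only [ha, (hδ _).1, (hδ _).2, or_self, if_false, mul_zero, Finset.sum_const_zero,
        add_zero]
      have hs : a ∉ P.sing := fun h => by
        rcases P.mem_sing_iff.1 h with ⟨k, hk⟩ | ⟨i, hi | hi⟩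
        · exact hω k hk
        · exact (hδ i).1 hi
        · exact (hδ i).2 hi
      rcases hind _ 0 (hP.tendsto_sub_sq_mul_v_of_notMem_sing hs) (by norm_num) with h | h
      · exact ⟨1, by rw [h]; rfl, by norm_num⟩
      · exact ⟨0, by rw [h]; rfl, le_rfl⟩

/-- Where its first integral vanishes, `Ξ` is the square of a solution of the second order
equation. -/
lemma Admissible.solvesHAt_of_sq_eq (hP : P.Admissible) {X g : ℂ → ℂ}
    (hX : X ∈ P.evenPeriodicSol) (hX0 : X ≠ 0) (hQ : ∀ x ∉ P.sing, P.Qexpr X x = 0)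
    (hg : ∀ x ∉ P.sing, AnalyticAt ℂ g x)
    (hsq : ∀ a, ∀ᶠ x in 𝓝[≠] a, g x ^ 2 = X x * P.psiSq x) {x : ℂ} (hx : x ∉ P.sing) :
    P.SolvesHAt g x := by
  intro ψ hψ
  have hm : Meromorphic X := hX.1
  have han : AnalyticOnNhd ℂ X P.singᶜ := hX.2.1
  set f : ℂ → ℂ := fun y => g y / ψ y with hf
  have hfa : AnalyticAt ℂ f x := (hg x hx).div hψ.1 (hψ.ne_zero hP hx)
  have hfX' : ∀ᶠ y in 𝓝[≠] x, X y = f y ^ 2 := by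
    filter_upwards [hsq x, hψ.eventually.filter_mono nhdsWithin_le_nhds,
      P.eventually_notMem_sing x] with y h1 h2 h3
    rw [hf, div_pow, h1, h2.sq_eq, mul_div_cancel_right₀ _ (hP.psiSq_ne_zero h3)]
  have hfX : X =ᶠ[𝓝 x] fun y => f y ^ 2 :=
    ((han x hx).frequently_eq_iff_eventually_eq (hfa.fun_pow 2)).1 hfX'.frequently
  have hXne := (meromorphicOrderAt_ne_top_iff_eventually_ne_zero (hm x)).1
    (order_ne_top_of_mem hX hX0 x)
  have hzero : ∀ᶠ y in 𝓝[≠] x, -iteratedDeriv 2 f y + (P.v y - P.E) * f y = 0 := by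
    filter_upwards [hfX.eventually_nhds.filter_mono nhdsWithin_le_nhds, hXne,
      P.eventually_notMem_sing x, hfa.eventually_analyticAt.filter_mono nhdsWithin_le_nhds]
      with y h1 h2 h3 h4
    have h1' : X =ᶠ[𝓝 y] fun y => f y ^ 2 := h1
    have h5 := hQ y h3
    rw [Qexpr, h1'.iteratedDeriv_eq, h1'.deriv_eq, h1'.self_of_nhds, first_integral_sq h4] at h5
    have hfy : f y ≠ 0 := by
      intro h0
      exact h2 (by simpa [h0] using h1'.self_of_nhds)
    have h6 := (mul_eq_zero.1 h5).resolve_left (pow_ne_zero 3 hfy)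
    linear_combination -h6
  have hta : ContinuousAt (fun y => -iteratedDeriv 2 f y + (P.v y - P.E) * f y) x := by
    have h1 := hfa.deriv.deriv.continuousAt
    have h2 := (hP.analyticAt_v hx).continuousAt
    have h3 := hfa.continuousAt
    simp only [iteratedDeriv_succ, iteratedDeriv_zero]
    fun_prop
  exact tendsto_nhds_unique_of_eventuallyEq (hta.tendsto.mono_left nhdsWithin_le_nhds)
    tendsto_const_nhds hzero

/-- If the first integral of `Ξ` vanishes, a global square root `g` of `Ξ Ψ_g ^ 2` represents a
solution in `𝓕̃`; its multipliers are `± 1` because those of `g ^ 2` are `1`. -/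
lemma Admissible.exists_hasSolutionInTildeF (hP : P.Admissible) {X : ℂ → ℂ}
    (hX : X ∈ P.evenPeriodicSol) (hX0 : X ≠ 0) (hQ : ∀ x ∉ P.sing, P.Qexpr X x = 0) :
    ∃ ε₁ ∈ ({1, -1} : Set ℂ), ∃ ε₃ ∈ ({1, -1} : Set ℂ), P.HasSolutionInTildeF ε₁ ε₃ := by
  have hm : Meromorphic X := hX.1
  have hFm : Meromorphic fun x => X x * P.psiSq x := fun x => (hm x).mul (P.meromorphic_psiSq x)
  choose n hn hn1 hn2 hn3 using hP.exists_order_mul_psiSq hX hX0 hQ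
  obtain ⟨g, hg, hsq⟩ := hFm.exists_sq_eq fun a => ⟨n a, hn a⟩
  have hgm : Meromorphic g := fun a => (hg (Set.mem_univ a)).meromorphicAt
  have hord : ∀ a, meromorphicOrderAt g a = (n a : WithTop ℤ) := by
    intro a
    have h1 : meromorphicOrderAt (fun x => g x ^ 2) a = ((2 * n a : ℤ) : WithTop ℤ) :=
      (meromorphicOrderAt_congr (hsq a)).trans (hn a)
    rw [fun_meromorphicOrderAt_pow (hgm a),
      show ((2 : ℕ) : WithTop ℤ) = ((2 : ℤ) : WithTop ℤ) from rfl] at h1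
    cases h : meromorphicOrderAt g a with
    | top =>
      rw [h, WithTop.mul_top (by decide)] at h1
      exact absurd h1 WithTop.top_ne_coe
    | coe k =>
      rw [h, ← WithTop.coe_mul, WithTop.coe_inj] at h1
      congr 1
      omega
  have hga : AnalyticOnNhd ℂ g P.halfLatticeᶜ := by
    intro a ha
    rw [← (hg (Set.mem_univ a)).meromorphicOrderAt_nonneg_iff_analyticAt, hord a]
    exact_mod_cast hn1 a ha
  have hper : ∀ c ∈ P.lattice.lattice, (∀ x, X (x + c) = X x) →
      ∃ ε ∈ ({1, -1} : Set ℂ), ∀ x, g (x + c) = ε * g x := by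
    intro c hc hXc
    have hgc : MeromorphicNFOn (fun x => g (x + c)) Set.univ := fun a _ =>
      (meromorphicNFAt_comp_add_const_iff_meromorphicNFAt (f := g)).2 (hg (Set.mem_univ _))
    have hs : ∀ a ∈ Set.univ, ∀ᶠ x in 𝓝[≠] a, g (x + c) ^ 2 = g x ^ 2 := by
      intro a _
      have ht : Tendsto (fun x : ℂ => x + c) (𝓝[≠] a) (𝓝[≠] (a + c)) := by
        refine tendsto_nhdsWithin_iff.2 ⟨((continuous_id.add_const c).tendsto a).mono_left
          nhdsWithin_le_nhds, ?_⟩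
        filter_upwards [self_mem_nhdsWithin] with x hx
        simpa using hx
      filter_upwards [hsq a, ht.eventually (hsq (a + c))] with x h1 h2
      rw [h1, h2, hXc, P.psiSq_add_of_mem hc]
    rcases hgc.eqOn_or_eqOn_neg isPreconnected_univ hg hs with h | h
    · exact ⟨1, by simp, fun x => by rw [h x trivial, one_mul]⟩
    · exact ⟨-1, by simp, fun x => by rw [h x trivial]; ring⟩
  obtain ⟨ε₁, hε₁, h1⟩ := hper _ (P.two_mul_ω_mem 1) hX.2.2.2.2.1
  obtain ⟨ε₃, hε₃, h3⟩ := hper _ (P.two_mul_ω_mem 3) hX.2.2.2.2.2.1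
  refine ⟨ε₁, hε₁, ε₃, hε₃, g, ⟨⟨hgm, Eventually.of_forall h1, Eventually.of_forall h3⟩, hga,
    fun i hi => ?_, ?_⟩, ?_, fun x hx => ?_⟩
  · rw [hord]
    exact_mod_cast hn2 (P.ω i) i hi (by rw [← two_mul]; exact P.two_mul_ω_mem i)
  · rw [hord]
    exact_mod_cast hn3 (P.ω 0) (by simp [ω])
  · have hne := (meromorphicOrderAt_ne_top_iff_eventually_ne_zero (hm 0)).1
      (order_ne_top_of_mem hX hX0 0)
    obtain ⟨x, h1, h2, h3⟩ := ((hsq 0).and ((P.eventually_notMem_sing 0).and hne)).exists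
    refine ⟨x, h2, fun h0 => ?_⟩
    rw [h0] at h1
    exact mul_ne_zero h3 (hP.psiSq_ne_zero h2) (by rw [← h1]; norm_num)
  · exact hP.solvesHAt_of_sq_eq hX hX0 hQ (fun y hy => hga y fun h => hy (Or.inl h)) hsq hx

end EllipticParams

end

theorem mainTheorem8 (P : EllipticParams) (hP : P.Admissible)
    (happ : ∀ i, P.IsApparent (P.δ i) ∧ P.IsApparent (-P.δ i))
    (hdim : Module.finrank ℂ P.evenPeriodicSol = 1)
    (Ξ : ℂ → ℂ) (hΞ : Ξ ∈ P.evenPeriodicSol) (hΞ0 : Ξ ≠ 0) :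
    ∃ Q : ℂ, (∀ x ∉ P.sing, P.Qexpr Ξ x = Q) ∧
      (Q = 0 ↔ ∃ ε₁ ∈ ({1, -1} : Set ℂ), ∃ ε₃ ∈ ({1, -1} : Set ℂ),
        P.HasSolutionInTildeF ε₁ ε₃) := by
  obtain ⟨Q, hQ⟩ := hP.exists_Qexpr_eq hΞ
  refine ⟨Q, hQ, fun h => ?_, ?_⟩
  · exact hP.exists_hasSolutionInTildeF hΞ hΞ0 fun x hx => (hQ x hx).trans h
  · rintro ⟨ε₁, h₁, ε₃, h₃, g, hg, hne, hs⟩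
    have hsq : ∀ ε ∈ ({1, -1} : Set ℂ), ε ^ 2 = 1 := by
      rintro ε (rfl | rfl) <;> norm_num
    obtain ⟨x, hx, hgx⟩ := hne
    rw [← hQ x hx]
    exact (EllipticParams.isSol_of_mem_tildeF hg hs).Qexpr_eq_zero hP hdim (hsq ε₁ h₁)
      (hsq ε₃ h₃) ⟨x, hx, hgx⟩
      hΞ hx
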